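/- **Setting.** Let $\mathcal A,\mathcal B>0$, $\beta\in(\pi/2,\pi)$, $\theta_c\in(0,\pi]$. Consider three curves $\Gamma_i=\{(r_i(\alpha),z_i(\alpha)):\alpha\in[0,1]\}$, $i=1,2,3$, in the meridian cross-section $\{0\le r\le 1,\ z\ge 0\}$, smooth up to the end points and possibly depending on time $t$, parametrized proportionally to arc length ($r_{i\alpha}r_{i\alpha\alpha}+z_{i\alpha}z_{i\alpha\alpha}=0$), with unit tangents $\hat\tau_i=(\cos\theta_i,\sin\theta_i)$, where $\theta_i$ is continuous with values in $(-\pi,\pi]$, and with mean curvatures $$H_i=\frac{r_{i\alpha}z_{i\alpha\alpha}-z_{i\alpha}r_{i\alpha\alpha}}{2(r_{i\alpha}^2+z_{i\alpha}^2)^{3/2}}+\frac{z_{i\alpha}}{2r_i\sqrt{r_{i\alpha}^2+z_{i\alpha}^2}} .$$ The evolution problem consists of: * the equations of motion, for $\alpha\in(0,1)$: $r_{i\alpha}z_{it}-z_{i\alpha}r_{it}=-\mathcal B\,(r_iH_{i\alpha})_\alpha/\bigl(r_i\sqrt{r_{i\alpha}^2+z_{i\alpha}^2}\bigr)$ for $i=1,2$,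 and $r_{3\alpha}z_{3t}-z_{3\alpha}r_{3t}=\mathcal A\sqrt{r_{3\alpha}^2+z_{3\alpha}^2}\,H_3$; * the end point conditions: $\Gamma_1$ runs from $(r_1^*,0)$ to the triple junction $(r_J,z_J)$, $\Gamma_2$ from $(r_J,z_J)$ to $(1,z_2^*)$, $\Gamma_3$ from $(r_3^*,0)$ to $(r_J,z_J)$, with $0<r_1^*<r_3^*<1$, $z_2^*>0$, $0<r_J<1$, $z_J>0$; * the angle conditions $\theta_1(0)=\theta_c$, $\theta_2(1)=0$, $\theta_3(0)=\pi/2$, $-\theta_1(1)+\theta_3(1)=\beta$, $\theta_2(0)-\theta_3(1)=\beta-\pi$; * continuity of the chemical potential, $H_1(1)=H_2(0)$, and balance of mass flux, $H_{1\alpha}(0)=0$, $H_{2\alpha}(1)=0$, $\dfrac{H_{1\alpha}}{\sqrt{r_{1\alpha}^2+z_{1\alpha}^2}}\Big|_{\alpha=1}=\dfrac{H_{2\alpha}}{\sqrt{r_{2\alpha}^2+z_{2\alpha}^2}}\Big|_{\alpha=0}$; * the geometric conditions: $0<r_1,r_3<1$ on $[0,1]$, $0<r_2<1$ on $[0,1)$,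 $z_1,z_3>0$ on $(0,1]$, $z_2>0$ on $[0,1]$; no curve intersects itself, and any two of the curves meet only at $(r_J,z_J)$. A *steady state* is a time-independent solution of this problem. **The formula.** For real parameters $\bar r,A,\lambda,a_\ell$ with $a_\ell\ge 0$ put $\bar\theta_3=\arcsin(A/\bar r)$, $\bar\theta_1=\bar\theta_3-\beta$, $\bar\theta_2=\bar\theta_3-\pi+\beta$, $\bar z=A\operatorname{arcosh}(\bar r/A)$ and $$r_1(\theta)=\frac{\sin\theta-\sqrt{\sin^2\theta+4\lambda^2a_\ell^2}}{2\lambda},\quad z_1(\theta)=-\frac1{2\lambda}\int_{\bar\theta_1}^{\theta}\Bigl(\frac{\sin^2x}{\sqrt{\sin^2x+4\lambda^2a_\ell^2}}-\sin x\Bigr)dx+\bar z,\quad \theta\in[\bar\theta_1,\theta_c],$$ $$r_2(\theta)=\frac{\sin\theta-\sqrt{\sin^2\theta+4\lambda^2}}{2\lambda},\quad z_2(\theta)=-\frac1{2\lambda}\int_{\bar\theta_2}^{\theta}\Bigl(\frac{\sin^2x}{\sqrt{\sin^2x+4\lambda^2}}-\sin x\Bigr)dx+\bar z,\quad \theta\in[0,\bar\theta_2],$$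 $$r_3(\theta)=\frac{A}{\sin\theta},\quad z_3(\theta)=A\log\frac{1+\cos\theta}{\sin\theta},\quad \theta\in[\bar\theta_3,\pi/2].$$ The formula *constitutes a steady state* if there is a steady state such that, for each $i$, the angle function $\theta_i(\alpha)$ of its $i$-th curve maps $[0,1]$ onto the interval above and the $i$-th curve is given by $(r_i(\theta_i(\alpha)),z_i(\theta_i(\alpha)))$. **Theorem.** Let $\beta\in(\pi/2,\pi)$, $\theta_c\in(0,\pi]$ and $a_\ell\ge0$. The formula constitutes a steady state if and only if the parameters satisfy * (C1) $0<A<\bar r<1$; (C2) $\lambda<0$; (C3) $0<a_\ell<1$; * (C4) $\bar r=r_2(\bar\theta_2)$; (C5) $r_1(\bar\theta_1)=\bar r$; (C6) $z_1(\theta_c)=0$; * (C7) if $\bar\theta_1<-\pi/2$, then $r_1(-\pi/2)<1$; * (C8) $\{(r_1(\theta),z_1(\theta)):\theta\in[\bar\theta_1,\theta_c]\}\cap\{(r_3(\theta),z_3(\theta)):\theta\in[\bar\theta_3,\pi/2]\}=\{(\bar r,\bar z)\}$. Moreover, if (C1)–(C7) and (C8′) $a_\ell<A$ hold, then (C8)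 holds. -/

import Mathlib

open Real Set
open scoped ContDiff

namespace GrainHole

noncomputable section

/-- A parametrized curve `α ↦ (r α, z α)`, `α ∈ [0,1]`, in the meridian half-plane, together with
an angle description `θ`, the angle between the unit tangent and the positive `r`-axis.
Only the values on `[0,1]` matter. -/
structure Curve where
  r : ℝ → ℝ
  z : ℝ → ℝ
  θ : ℝ → ℝ

namespace Curve

variable (c : Curve)

/-- `r_α` (one-sided at the end points). -/
def dr (α : ℝ) : ℝ := derivWithin c.r (Icc 0 1) α

/-- `z_α`. -/
def dz (α : ℝ) : ℝ := derivWithin c.z (Icc 0 1) α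

/-- `r_αα`. -/
def ddr (α : ℝ) : ℝ := derivWithin c.dr (Icc 0 1) α

/-- `z_αα`. -/
def ddz (α : ℝ) : ℝ := derivWithin c.dz (Icc 0 1) α

/-- `√(r_α² + z_α²)`. -/
def speed (α : ℝ) : ℝ := √(c.dr α ^ 2 + c.dz α ^ 2)

/-- The component of the unit tangent in the `r` direction. -/
def τr (α : ℝ) : ℝ := c.dr α / c.speed α

/-- The component of the unit tangent in the `z` direction. -/
def τz (α : ℝ) : ℝ := c.dz α / c.speed α

/-- Mean curvature (average of the principal curvatures) of the surface of revolution generated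
by the curve. -/
def H (α : ℝ) : ℝ :=
  (c.dr α * c.ddz α - c.dz α * c.ddr α) / (2 * c.speed α ^ 3)
    + c.dz α / (2 * c.r α * c.speed α)

/-- `H_α`. -/
def dH (α : ℝ) : ℝ := derivWithin c.H (Icc 0 1) α

/-- `(r H_α)_α`. -/
def drdH (α : ℝ) : ℝ := derivWithin (fun x => c.r x * c.dH x) (Icc 0 1) α

/-- The set of points of the curve. -/
def trace : Set (ℝ × ℝ) := (fun α => (c.r α, c.z α)) '' Icc 0 1

end Curve

/-- The meridian cross-section of the bounding cylinder of radius `1`. -/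
def meridian : Set (ℝ × ℝ) := {x | 0 ≤ x.1 ∧ x.1 ≤ 1 ∧ 0 ≤ x.2}

/-- A configuration: inner exterior curve `Γ₁`, outer exterior curve `Γ₂`, grain boundary `Γ₃`, and
the points `(r₁s, 0)`, `(1, z₂s)`, `(r₃s, 0)` and the triple junction `(rJ, zJ)`. -/
structure Config where
  Γ₁ : Curve
  Γ₂ : Curve
  Γ₃ : Curve
  r₁s : ℝ
  z₂s : ℝ
  r₃s : ℝ
  rJ : ℝ
  zJ : ℝ

/-- `[0, T)`, with `T = ⊤` allowed. -/
def timeCO (T : EReal) : Set ℝ := {t | 0 ≤ t ∧ (t : EReal) < T}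

/-- `(0, T)`, with `T = ⊤` allowed. -/
def timeOO (T : EReal) : Set ℝ := {t | 0 < t ∧ (t : EReal) < T}

/-- The conditions imposed on each of the three moving curves on its own: regularity,
(normalized arc-length) parametrization, angle description, no self-intersection, and being
contained in the meridian cross-section. -/
structure IsAdmissibleCurve (T : EReal) (Γ : ℝ → Curve) : Prop where
  smooth_r : ContDiffOn ℝ ∞ (fun x : ℝ × ℝ => (Γ x.2).r x.1) (Icc 0 1 ×ˢ timeCO T)
  smooth_z : ContDiffOn ℝ ∞ (fun x : ℝ × ℝ => (Γ x.2).z x.1) (Icc 0 1 ×ˢ timeCO T)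
  continuous_θ : ContinuousOn (fun x : ℝ × ℝ => (Γ x.2).θ x.1) (Icc 0 1 ×ˢ timeCO T)
  arclength : ∀ t ∈ timeCO T, ∀ α ∈ Icc (0 : ℝ) 1,
    (Γ t).dr α * (Γ t).ddr α + (Γ t).dz α * (Γ t).ddz α = 0
  cos_θ : ∀ t ∈ timeCO T, ∀ α ∈ Icc (0 : ℝ) 1, cos ((Γ t).θ α) = (Γ t).τr α
  sin_θ : ∀ t ∈ timeCO T, ∀ α ∈ Icc (0 : ℝ) 1, sin ((Γ t).θ α) = (Γ t).τz α
  range_θ : ∀ t ∈ timeCO T, ∀ α ∈ Icc (0 : ℝ) 1, (Γ t).θ α ∈ Ioc (-π) π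
  not_self_intersecting : ∀ t ∈ timeCO T,
    InjOn (fun α => ((Γ t).r α, (Γ t).z α)) (Icc (0 : ℝ) 1)
  in_meridian : ∀ t ∈ timeCO T, (Γ t).trace ⊆ meridian

/-- The dynamic problem on the time interval `[0, T)`: surface diffusion (Mullins coefficient
`ℬ`) for the exterior curves, mean curvature motion (reduced mobility `𝒜`) for the grain boundary,
persistence, balance of mechanical forces, continuity of the chemical potential, balance of the mass
flux, and absence of additional contacts and intersections. -/
structure IsSolution (𝒜 ℬ β θc : ℝ) (T : EReal) (S : ℝ → Config) : Prop where
  adm₁ : IsAdmissibleCurve T (fun t => (S t).Γ₁)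
  adm₂ : IsAdmissibleCurve T (fun t => (S t).Γ₂)
  adm₃ : IsAdmissibleCurve T (fun t => (S t).Γ₃)
  -- equations of motion
  motion₁ : ∀ t ∈ timeOO T, ∀ α ∈ Ioo (0 : ℝ) 1,
    (S t).Γ₁.dr α * deriv (fun s => (S s).Γ₁.z α) t
      - (S t).Γ₁.dz α * deriv (fun s => (S s).Γ₁.r α) t
      = -ℬ * (S t).Γ₁.drdH α / ((S t).Γ₁.r α * (S t).Γ₁.speed α)
  motion₂ : ∀ t ∈ timeOO T, ∀ α ∈ Ioo (0 : ℝ) 1,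
    (S t).Γ₂.dr α * deriv (fun s => (S s).Γ₂.z α) t
      - (S t).Γ₂.dz α * deriv (fun s => (S s).Γ₂.r α) t
      = -ℬ * (S t).Γ₂.drdH α / ((S t).Γ₂.r α * (S t).Γ₂.speed α)
  motion₃ : ∀ t ∈ timeOO T, ∀ α ∈ Ioo (0 : ℝ) 1,
    (S t).Γ₃.dr α * deriv (fun s => (S s).Γ₃.z α) t
      - (S t).Γ₃.dz α * deriv (fun s => (S s).Γ₃.r α) t
      = 𝒜 * (S t).Γ₃.speed α * (S t).Γ₃.H α
  -- end points
  start₁ : ∀ t ∈ timeCO T, (S t).Γ₁.r 0 = (S t).r₁s ∧ (S t).Γ₁.z 0 = 0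
  end₁ : ∀ t ∈ timeCO T, (S t).Γ₁.r 1 = (S t).rJ ∧ (S t).Γ₁.z 1 = (S t).zJ
  start₂ : ∀ t ∈ timeCO T, (S t).Γ₂.r 0 = (S t).rJ ∧ (S t).Γ₂.z 0 = (S t).zJ
  end₂ : ∀ t ∈ timeCO T, (S t).Γ₂.r 1 = 1 ∧ (S t).Γ₂.z 1 = (S t).z₂s
  start₃ : ∀ t ∈ timeCO T, (S t).Γ₃.r 0 = (S t).r₃s ∧ (S t).Γ₃.z 0 = 0
  end₃ : ∀ t ∈ timeCO T, (S t).Γ₃.r 1 = (S t).rJ ∧ (S t).Γ₃.z 1 = (S t).zJ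
  points_order : ∀ t ∈ timeCO T,
    0 < (S t).r₁s ∧ (S t).r₁s < (S t).r₃s ∧ (S t).r₃s < 1 ∧ 0 < (S t).z₂s ∧
      0 < (S t).rJ ∧ (S t).rJ < 1 ∧ 0 < (S t).zJ
  -- balance of mechanical forces
  force_substrate₁ : ∀ t ∈ timeCO T, (S t).Γ₁.τr 0 = cos θc ∧ (S t).Γ₁.θ 0 = θc
  force_cylinder : ∀ t ∈ timeCO T, (S t).Γ₂.τz 1 = 0 ∧ (S t).Γ₂.θ 1 = 0
  force_substrate₃ : ∀ t ∈ timeCO T, (S t).Γ₃.τr 0 = 0 ∧ (S t).Γ₃.θ 0 = π / 2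
  force_junction₁ : ∀ t ∈ timeCO T,
    (S t).Γ₁.τr 1 * (S t).Γ₃.τr 1 + (S t).Γ₁.τz 1 * (S t).Γ₃.τz 1 = cos β ∧
      -(S t).Γ₁.θ 1 + (S t).Γ₃.θ 1 = β
  force_junction₂ : ∀ t ∈ timeCO T,
    -((S t).Γ₂.τr 0 * (S t).Γ₃.τr 1 + (S t).Γ₂.τz 0 * (S t).Γ₃.τz 1) = cos β ∧
      (S t).Γ₂.θ 0 - (S t).Γ₃.θ 1 = -π + β
  -- chemical potential and mass flux
  chemical_potential : ∀ t ∈ timeCO T, (S t).Γ₁.H 1 = (S t).Γ₂.H 0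
  flux_substrate : ∀ t ∈ timeCO T, (S t).Γ₁.dH 0 = 0
  flux_junction : ∀ t ∈ timeCO T,
    (S t).Γ₁.dH 1 / (S t).Γ₁.speed 1 = (S t).Γ₂.dH 0 / (S t).Γ₂.speed 0
  flux_cylinder : ∀ t ∈ timeCO T, (S t).Γ₂.dH 1 = 0
  -- no contact with the axis, the cylinder or the substrate except at the prescribed end points
  r₁_mem : ∀ t ∈ timeCO T, ∀ α ∈ Icc (0 : ℝ) 1, (S t).Γ₁.r α ∈ Ioo (0 : ℝ) 1
  r₃_mem : ∀ t ∈ timeCO T, ∀ α ∈ Icc (0 : ℝ) 1, (S t).Γ₃.r α ∈ Ioo (0 : ℝ) 1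
  r₂_mem : ∀ t ∈ timeCO T, ∀ α ∈ Ico (0 : ℝ) 1, (S t).Γ₂.r α ∈ Ioo (0 : ℝ) 1
  z₁_pos : ∀ t ∈ timeCO T, ∀ α ∈ Ioc (0 : ℝ) 1, 0 < (S t).Γ₁.z α
  z₃_pos : ∀ t ∈ timeCO T, ∀ α ∈ Ioc (0 : ℝ) 1, 0 < (S t).Γ₃.z α
  z₂_pos : ∀ t ∈ timeCO T, ∀ α ∈ Icc (0 : ℝ) 1, 0 < (S t).Γ₂.z α
  -- the curves meet only at the triple junction
  inter₁₂ : ∀ t ∈ timeCO T, (S t).Γ₁.trace ∩ (S t).Γ₂.trace = {((S t).rJ, (S t).zJ)}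
  inter₁₃ : ∀ t ∈ timeCO T, (S t).Γ₁.trace ∩ (S t).Γ₃.trace = {((S t).rJ, (S t).zJ)}
  inter₂₃ : ∀ t ∈ timeCO T, (S t).Γ₂.trace ∩ (S t).Γ₃.trace = {((S t).rJ, (S t).zJ)}

/-- A steady state: a configuration which, kept constant in time, solves the dynamic problem for
all times. -/
def IsSteadyState (𝒜 ℬ β θc : ℝ) (S : Config) : Prop :=
  IsSolution 𝒜 ℬ β θc ⊤ (fun _ => S)

/-! ### The explicit formula -/

/-- The nodoid radius with mean curvature `lam` and parameter `a`, as a function of the angle. -/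
def nodoidR (lam a θ : ℝ) : ℝ := (sin θ - √(sin θ ^ 2 + 4 * lam ^ 2 * a ^ 2)) / (2 * lam)

/-- The nodoid height, normalized to be `z₀` at the angle `θ₀`. -/
def nodoidZ (lam a θ₀ z₀ θ : ℝ) : ℝ :=
  -1 / (2 * lam) *
    (∫ x in θ₀..θ, (sin x ^ 2 / √(sin x ^ 2 + 4 * lam ^ 2 * a ^ 2) - sin x)) + z₀

/-- The four parameters `r̄`, `A`, `λ`, `a_ℓ` of the formula. -/
structure Params where
  rbar : ℝ
  A : ℝ
  lam : ℝ
  al : ℝ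

namespace Params

variable (p : Params) (β θc : ℝ)

def θbar₃ : ℝ := arcsin (p.A / p.rbar)

def θbar₁ : ℝ := p.θbar₃ - β

def θbar₂ : ℝ := p.θbar₃ - π + β

def zbar : ℝ := p.A * arcosh (p.rbar / p.A)

def r₁ (θ : ℝ) : ℝ := nodoidR p.lam p.al θ

def z₁ (θ : ℝ) : ℝ := nodoidZ p.lam p.al (p.θbar₁ β) p.zbar θ

def r₂ (θ : ℝ) : ℝ := nodoidR p.lam 1 θ

def z₂ (θ : ℝ) : ℝ := nodoidZ p.lam 1 (p.θbar₂ β) p.zbar θ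

def r₃ (θ : ℝ) : ℝ := p.A / sin θ

def z₃ (θ : ℝ) : ℝ := p.A * log ((1 + cos θ) / sin θ)

/-- The point set of the first arc of the formula, `θ₁ ∈ [θ̄₁, θ_c]`. -/
def Γ₁ : Set (ℝ × ℝ) := (fun θ => (p.r₁ θ, p.z₁ β θ)) '' Icc (p.θbar₁ β) θc

/-- The point set of the third arc of the formula, `θ₃ ∈ [θ̄₃, π/2]`. -/
def Γ₃ : Set (ℝ × ℝ) := (fun θ => (p.r₃ θ, p.z₃ θ)) '' Icc p.θbar₃ (π / 2)

end Params

/-- The curve `c` is expressed, in terms of its own angle variable, by the functions `R`, `Z` on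
the interval `[lo, hi]`. -/
def Curve.IsExpressedBy (c : Curve) (R Z : ℝ → ℝ) (lo hi : ℝ) : Prop :=
  c.θ '' Icc 0 1 = Icc lo hi ∧
    ∀ α ∈ Icc (0 : ℝ) 1, c.r α = R (c.θ α) ∧ c.z α = Z (c.θ α)

/-- The formula with parameters `p` constitutes a steady state: there is a steady state whose
three curves, in terms of their angle variables, are given by the formula. -/
def FormulaIsSteadyState (𝒜 ℬ β θc : ℝ) (p : Params) : Prop :=
  ∃ S : Config, IsSteadyState 𝒜 ℬ β θc S ∧
    S.Γ₁.IsExpressedBy p.r₁ (p.z₁ β) (p.θbar₁ β) θc ∧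
    S.Γ₂.IsExpressedBy p.r₂ (p.z₂ β) 0 (p.θbar₂ β) ∧
    S.Γ₃.IsExpressedBy p.r₃ p.z₃ p.θbar₃ (π / 2)

/-- Constraints (C1)–(C7). -/
structure ConstraintsC1C7 (β θc : ℝ) (p : Params) : Prop where
  c1 : 0 < p.A ∧ p.A < p.rbar ∧ p.rbar < 1
  c2 : p.lam < 0
  c3 : 0 < p.al ∧ p.al < 1
  c4 : p.rbar = p.r₂ (p.θbar₂ β)
  c5 : p.r₁ (p.θbar₁ β) = p.rbar
  c6 : p.z₁ β θc = 0
  c7 : p.θbar₁ β < -π / 2 → p.r₁ (-π / 2) < 1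

/-- Constraint (C8): the arcs `Γ₁` and `Γ₃` meet only at the triple junction. -/
def ConstraintC8 (β θc : ℝ) (p : Params) : Prop :=
  p.Γ₁ β θc ∩ p.Γ₃ = {(p.rbar, p.zbar)}

/-- Constraint (C8′). -/
def ConstraintC8' (p : Params) : Prop := p.al < p.A

end

end GrainHole

namespace GrainHole

/-! ### Curves parametrized by arc length, with decreasing angle -/

/-! Sufficiency: along a nodoid, $dr=-w\cos\theta\,d\theta$ and $dz=-w\sin\theta\,d\theta$ with
$w>0$, so the arc length is a monotone function of the angle and can be inverted to give a smooth
constant-speed curve. Its mean curvature is $(\sin\theta/r-1/w)/2=\lambda$; the catenoid has the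
same structure with mean curvature $0$. Both exterior curves share the constant $\lambda$, so the
equations of motion and the potential and flux conditions hold. The geometric conditions remain.
Each nodoid radius is a decreasing function of $\sin\theta$, and its height rises for $\theta<0$ and
falls for $\theta>0$; this gives the bounds and simplicity. The exterior curves are separated by a
tangent line (`inter_exterior`), the outer curve and the grain boundary by the line $r=\bar r$
(`inter_outer_boundary`). The order $r_1^*<r_3^*$ is not among the constraints; it follows from (C8)
by the intermediate value theorem (`r₁_θc_lt`).

Necessity: simplicity makes the angle of $\Gamma_3$ monotone, which places the junction at
$\bar\theta_3$; the constraints are then read off from the end points and the bounds on the radii.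
-/

/-- The curve `c` traverses the arc `θ ↦ (R θ, Z θ)`, `θ ∈ [lo, hi]`, smoothly, with speed
independent of the parameter and decreasing angle, and its mean curvature is `h`. -/
structure Curve.IsArc (c : Curve) (R Z : ℝ → ℝ) (lo hi h : ℝ) : Prop where
  smooth_r : ContDiff ℝ ∞ c.r
  smooth_z : ContDiff ℝ ∞ c.z
  smooth_θ : ContDiff ℝ ∞ c.θ
  arclength : ∀ α ∈ Icc (0 : ℝ) 1, c.dr α * c.ddr α + c.dz α * c.ddz α = 0
  cos_θ : ∀ α ∈ Icc (0 : ℝ) 1, cos (c.θ α) = c.τr α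
  sin_θ : ∀ α ∈ Icc (0 : ℝ) 1, sin (c.θ α) = c.τz α
  H_eq : ∀ α ∈ Icc (0 : ℝ) 1, c.H α = h
  strictAnti : StrictAnti c.θ
  θ_zero : c.θ 0 = hi
  θ_one : c.θ 1 = lo
  r_eq : ∀ α, c.r α = R (c.θ α)
  z_eq : ∀ α, c.z α = Z (c.θ α)

/-- `w` is minus the derivative of arc length with respect to the angle. The chain rule cancels it,
leaving the velocity $\ell(\cos\theta,\sin\theta)$, so $\theta$ is the tangent angle and the
meridian curvature is $\theta_\alpha/\ell=-1/w$. -/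
theorem isArc_of_angle {θ R Z w : ℝ → ℝ} {ℓ h : ℝ} (hℓ : 0 < ℓ) (hsm : ContDiff ℝ ∞ θ)
    (hw : ∀ α, 0 < w (θ α)) (hθ : ∀ α, HasDerivAt θ (-ℓ / w (θ α)) α)
    (hR : ∀ α, HasDerivAt R (-w (θ α) * cos (θ α)) (θ α))
    (hZ : ∀ α, HasDerivAt Z (-w (θ α) * sin (θ α)) (θ α))
    (hH : ∀ α, (sin (θ α) / R (θ α) - 1 / w (θ α)) / 2 = h) :
    (⟨fun α => R (θ α), fun α => Z (θ α), θ⟩ : Curve).IsArc R Z (θ 1) (θ 0) h := by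
  have hr : ∀ α, HasDerivAt (fun α => R (θ α)) (ℓ * cos (θ α)) α := fun α => by
    refine ((hR α).comp α (hθ α)).congr_deriv ?_
    have := (hw α).ne'
    field_simp
  have hz : ∀ α, HasDerivAt (fun α => Z (θ α)) (ℓ * sin (θ α)) α := fun α => by
    refine ((hZ α).comp α (hθ α)).congr_deriv ?_
    have := (hw α).ne'
    field_simp
  set c : Curve := ⟨fun α => R (θ α), fun α => Z (θ α), θ⟩ with hc
  have hu : ∀ α ∈ Icc (0 : ℝ) 1, UniqueDiffWithinAt ℝ (Icc (0 : ℝ) 1) α :=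
    fun α hα => uniqueDiffOn_Icc zero_lt_one α hα
  have hdr : ∀ α ∈ Icc (0 : ℝ) 1, c.dr α = ℓ * cos (θ α) :=
    fun α hα => (hr α).hasDerivWithinAt.derivWithin (hu α hα)
  have hdz : ∀ α ∈ Icc (0 : ℝ) 1, c.dz α = ℓ * sin (θ α) :=
    fun α hα => (hz α).hasDerivWithinAt.derivWithin (hu α hα)
  have hddr : ∀ α ∈ Icc (0 : ℝ) 1, c.ddr α = ℓ * (-sin (θ α) * (-ℓ / w (θ α))) := fun α hα => by
    have h1 : HasDerivAt (fun x => ℓ * cos (θ x)) (ℓ * (-sin (θ α) * (-ℓ / w (θ α)))) α :=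
      (hθ α).cos.const_mul ℓ
    exact (h1.hasDerivWithinAt.congr hdr (hdr α hα)).derivWithin (hu α hα)
  have hddz : ∀ α ∈ Icc (0 : ℝ) 1, c.ddz α = ℓ * (cos (θ α) * (-ℓ / w (θ α))) := fun α hα => by
    have h1 : HasDerivAt (fun x => ℓ * sin (θ x)) (ℓ * (cos (θ α) * (-ℓ / w (θ α)))) α :=
      (hθ α).sin.const_mul ℓ
    exact (h1.hasDerivWithinAt.congr hdz (hdz α hα)).derivWithin (hu α hα)
  have hsp : ∀ α ∈ Icc (0 : ℝ) 1, c.speed α = ℓ := fun α hα => by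
    rw [Curve.speed, hdr α hα, hdz α hα]
    have : (ℓ * cos (θ α)) ^ 2 + (ℓ * sin (θ α)) ^ 2 = ℓ ^ 2 := by
      linear_combination ℓ ^ 2 * sin_sq_add_cos_sq (θ α)
    rw [this, Real.sqrt_sq hℓ.le]
  refine ⟨?_, ?_, hsm, ?_, ?_, ?_, ?_, ?_, rfl, rfl, fun _ => rfl, fun _ => rfl⟩
  -- Smoothness is inherited from $\theta$ through the first derivative $\ell\cos\theta$; none is
  -- needed for `R` or `Z`.
  · refine contDiff_infty_iff_deriv.2 ⟨fun α => (hr α).differentiableAt, ?_⟩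
    rw [show deriv c.r = fun α => ℓ * cos (θ α) from funext fun α => (hr α).deriv]
    fun_prop
  · refine contDiff_infty_iff_deriv.2 ⟨fun α => (hz α).differentiableAt, ?_⟩
    rw [show deriv c.z = fun α => ℓ * sin (θ α) from funext fun α => (hz α).deriv]
    fun_prop
  · intro α hα
    rw [hdr α hα, hdz α hα, hddr α hα, hddz α hα]
    ring
  · intro α hα
    rw [Curve.τr, hdr α hα, hsp α hα, mul_div_cancel_left₀ _ hℓ.ne']
  · intro α hα
    rw [Curve.τz, hdz α hα, hsp α hα, mul_div_cancel_left₀ _ hℓ.ne']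
  · intro α hα
    rw [Curve.H, hdr α hα, hdz α hα, hddr α hα, hddz α hα, hsp α hα, ← hH α]
    have h1 : ℓ * cos (θ α) * (ℓ * (cos (θ α) * (-ℓ / w (θ α)))) -
        ℓ * sin (θ α) * (ℓ * (-sin (θ α) * (-ℓ / w (θ α)))) = -(ℓ ^ 3 / w (θ α)) := by
      linear_combination -(ℓ ^ 3 / w (θ α)) * sin_sq_add_cos_sq (θ α)
    have h2 : ℓ * sin (θ α) / (2 * c.r α * ℓ) = sin (θ α) / R (θ α) / 2 := by
      rw [div_div, mul_comm ℓ, mul_div_mul_right _ _ hℓ.ne', mul_comm 2]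
    have h3 : -(ℓ ^ 3 / w (θ α)) / (2 * ℓ ^ 3) = -(1 / w (θ α)) / 2 := by
      have := (hw α).ne'
      field_simp
    rw [h1, h2, h3]
    ring
  · exact strictAnti_of_deriv_neg fun α => by
      rw [(hθ α).deriv]
      exact div_neg_of_neg_of_pos (neg_neg_of_pos hℓ) (hw α)

theorem Curve.IsArc.mem_Icc {c : Curve} {R Z : ℝ → ℝ} {lo hi h : ℝ} (hc : c.IsArc R Z lo hi h)
    {α : ℝ} (hα : α ∈ Icc (0 : ℝ) 1) : c.θ α ∈ Icc lo hi :=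
  ⟨hc.θ_one ▸ hc.strictAnti.antitone hα.2, hc.θ_zero ▸ hc.strictAnti.antitone hα.1⟩

theorem Curve.IsArc.image_θ {c : Curve} {R Z : ℝ → ℝ} {lo hi h : ℝ}
    (hc : c.IsArc R Z lo hi h) : c.θ '' Icc 0 1 = Icc lo hi := by
  refine Subset.antisymm ?_ ?_
  · rintro _ ⟨α, hα, rfl⟩
    exact hc.mem_Icc hα
  · have := intermediate_value_Icc' (zero_le_one (α := ℝ)) hc.smooth_θ.continuous.continuousOn
    rwa [hc.θ_one, hc.θ_zero] at this

theorem Curve.IsArc.isExpressedBy {c : Curve} {R Z : ℝ → ℝ} {lo hi h : ℝ}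
    (hc : c.IsArc R Z lo hi h) : c.IsExpressedBy R Z lo hi :=
  ⟨hc.image_θ, fun α _ => ⟨hc.r_eq α, hc.z_eq α⟩⟩

theorem Curve.IsExpressedBy.trace_eq {c : Curve} {R Z : ℝ → ℝ} {lo hi : ℝ}
    (hc : c.IsExpressedBy R Z lo hi) : c.trace = (fun θ => (R θ, Z θ)) '' Icc lo hi := by
  rw [← hc.1, image_image]
  exact image_congr fun α hα => by rw [(hc.2 α hα).1, (hc.2 α hα).2]

theorem Curve.IsArc.dH_eq {c : Curve} {R Z : ℝ → ℝ} {lo hi h : ℝ} (hc : c.IsArc R Z lo hi h)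
    {α : ℝ} (hα : α ∈ Icc (0 : ℝ) 1) : c.dH α = 0 := by
  rw [Curve.dH, derivWithin_congr (f := fun _ => h) hc.H_eq (hc.H_eq α hα)]
  simp

theorem Curve.IsArc.drdH_eq {c : Curve} {R Z : ℝ → ℝ} {lo hi h : ℝ} (hc : c.IsArc R Z lo hi h)
    {α : ℝ} (hα : α ∈ Icc (0 : ℝ) 1) : c.drdH α = 0 := by
  have h0 : ∀ x ∈ Icc (0 : ℝ) 1, c.r x * c.dH x = 0 := fun x hx => by rw [hc.dH_eq hx, mul_zero]
  rw [Curve.drdH, derivWithin_congr (f := fun _ => 0) h0 (h0 α hα)]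
  simp

theorem Curve.IsArc.isAdmissibleCurve {c : Curve} {R Z : ℝ → ℝ} {lo hi h : ℝ}
    (hc : c.IsArc R Z lo hi h) (hlo : -π < lo) (hhi : hi ≤ π)
    (hinj : InjOn (fun θ => (R θ, Z θ)) (Icc lo hi))
    (hmer : ∀ θ ∈ Icc lo hi, (R θ, Z θ) ∈ meridian) (T : EReal) :
    IsAdmissibleCurve T (fun _ => c) where
  smooth_r := (hc.smooth_r.comp contDiff_fst).contDiffOn
  smooth_z := (hc.smooth_z.comp contDiff_fst).contDiffOn
  continuous_θ := (hc.smooth_θ.continuous.comp continuous_fst).continuousOn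
  arclength _ _ := hc.arclength
  cos_θ _ _ := hc.cos_θ
  sin_θ _ _ := hc.sin_θ
  range_θ _ _ α hα := ⟨hlo.trans_le (hc.mem_Icc hα).1, (hc.mem_Icc hα).2.trans hhi⟩
  not_self_intersecting _ _ α hα α' hα' he := by
    refine hc.strictAnti.injective (hinj (hc.mem_Icc hα) (hc.mem_Icc hα') ?_)
    simpa only [hc.r_eq, hc.z_eq] using he
  in_meridian _ _ := by
    rw [hc.isExpressedBy.trace_eq]
    rintro _ ⟨θ, hθ, rfl⟩
    exact hmer θ hθ

/-- Inversion of the arc length as a function of the angle. -/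
theorem exists_angle_of_density {w : ℝ → ℝ} (hw : ContDiff ℝ ∞ w) {m : ℝ} (hm : 0 < m)
    (hmw : ∀ x, m ≤ w x) {lo hi : ℝ} (hlh : lo < hi) :
    ∃ θ : ℝ → ℝ, ∃ ℓ > 0, ContDiff ℝ ∞ θ ∧ θ 0 = hi ∧ θ 1 = lo ∧
      ∀ α, HasDerivAt θ (-ℓ / w (θ α)) α := by
  have hpos : ∀ x, 0 < w x := fun x => hm.trans_le (hmw x)
  set F : ℝ → ℝ := fun θ => ∫ x in hi..θ, w x with hF
  have hd : ∀ x, HasDerivAt F (w x) x := fun x =>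
    (hw.continuous.integral_hasStrictDerivAt hi x).hasDerivAt
  have hdiff : Differentiable ℝ F := fun x => (hd x).differentiableAt
  have hmono : StrictMono F := strictMono_of_deriv_pos fun x => by
    rw [(hd x).deriv]
    exact hpos x
  -- The lower bound `m` on the density forces at least linear growth of `F`, hence surjectivity.
  have hgrow := mul_sub_le_image_sub_of_le_deriv hdiff (C := m) (fun x => by
    rw [(hd x).deriv]
    exact hmw x)
  have hF0 : F hi = 0 := intervalIntegral.integral_same
  have hsurj : Function.Surjective F := by
    refine hdiff.continuous.surjective ?_ ?_
    · refine Filter.tendsto_atTop_mono' Filter.atTop ?_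
        ((Filter.tendsto_id.atTop_add (tendsto_const_nhds (x := -hi))).const_mul_atTop hm)
      filter_upwards [Filter.eventually_ge_atTop hi] with x hx
      have := @hgrow hi x hx
      simp only [id]
      linarith
    · refine Filter.tendsto_atBot_mono' Filter.atBot ?_
        ((Filter.tendsto_id.atBot_add (tendsto_const_nhds (x := -hi))).const_mul_atBot hm)
      filter_upwards [Filter.eventually_le_atBot hi] with x hx
      have := @hgrow x hi hx
      simp only [id]
      linarith
  set G : ℝ ≃ₜ ℝ := (hmono.orderIsoOfSurjective F hsurj).toHomeomorph with hG
  have hGF : ∀ x, G x = F x := fun _ => rfl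
  have hFsm : ContDiff ℝ ∞ F := contDiff_infty_iff_deriv.2 ⟨hdiff, by
    rwa [show deriv F = w from funext fun x => (hd x).deriv]⟩
  have hsymm : ContDiff ℝ ∞ G.symm :=
    G.contDiff_symm_deriv (f' := w) (fun x => (hpos x).ne') hd hFsm
  have hsd : ∀ y, HasDerivAt G.symm (w (G.symm y))⁻¹ y := fun y =>
    HasDerivAt.of_local_left_inverse G.symm.continuous.continuousAt (hd _) (hpos _).ne'
      (Filter.Eventually.of_forall fun z => G.apply_symm_apply z)
  have hℓ : 0 < -F lo := by
    have := hmono hlh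
    linarith
  -- `-F lo` is the total length; arc length is measured from `hi`, so running from $0$ down to `F
  -- lo` makes the angle decrease from `hi` to `lo`.
  refine ⟨fun α => G.symm (-(-F lo) * α), -F lo, hℓ, ?_, ?_, ?_, fun α => ?_⟩
  · exact hsymm.comp (contDiff_const.mul contDiff_id)
  · simp only [mul_zero]
    rw [← hF0, ← hGF, G.symm_apply_apply]
  · simp only [mul_one, neg_neg]
    rw [← hGF, G.symm_apply_apply]
  · refine ((hsd _).comp α ((hasDerivAt_id α).const_mul (-(-F lo)))).congr_deriv ?_
    simp only [id, mul_one]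
    ring

/-! ### Nodoids -/

/-- After squaring, the claim reduces to $x<\sqrt{x^2+c}$. Since $2\lambda<0$, it makes the nodoid
radius a strictly decreasing function of $\sin\theta$, which underlies all the radius comparisons.
-/
theorem strictMono_sub_sqrt {c : ℝ} (hc : 0 < c) : StrictMono fun s : ℝ => s - √(s ^ 2 + c) := by
  intro x y hxy
  have hx : x < √(x ^ 2 + c) := by
    refine (le_abs_self x).trans_lt ?_
    rw [← Real.sqrt_sq_eq_abs]
    exact Real.sqrt_lt_sqrt (sq_nonneg x) (by linarith)
  have h : √(y ^ 2 + c) < √(x ^ 2 + c) + (y - x) := by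
    have h0 := Real.sqrt_nonneg (x ^ 2 + c)
    rw [Real.sqrt_lt' (by linarith)]
    have h1 := Real.sq_sqrt (show 0 ≤ x ^ 2 + c by positivity)
    have h2 := mul_lt_mul_of_pos_right hx (sub_pos.2 hxy)
    nlinarith
  simp only
  linarith

/-- `√(sin² θ + 4 λ² a²)`. -/
noncomputable def nodoidD (lam a θ : ℝ) : ℝ := √(sin θ ^ 2 + 4 * lam ^ 2 * a ^ 2)

/-- Minus the derivative of the arc length of a nodoid with respect to its angle. -/
noncomputable def nodoidW (lam a θ : ℝ) : ℝ := nodoidR lam a θ / nodoidD lam a θ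

section Nodoid

variable {lam a : ℝ}

theorem nodoid_const_pos (hl : lam < 0) (ha : 0 < a) : 0 < 4 * lam ^ 2 * a ^ 2 := by
  have := pow_pos ha 2
  have := pow_pos (neg_pos.2 hl) 2
  rw [neg_sq] at this
  positivity

theorem nodoidD_pos (hl : lam < 0) (ha : 0 < a) (θ : ℝ) : 0 < nodoidD lam a θ :=
  Real.sqrt_pos.2 (add_pos_of_nonneg_of_pos (sq_nonneg _) (nodoid_const_pos hl ha))

theorem sq_nodoidD (lam a θ : ℝ) : nodoidD lam a θ ^ 2 = sin θ ^ 2 + 4 * lam ^ 2 * a ^ 2 :=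
  Real.sq_sqrt (by positivity)

theorem contDiff_nodoidD (hl : lam < 0) (ha : 0 < a) : ContDiff ℝ ∞ (nodoidD lam a) :=
  ((contDiff_sin.pow 2).add contDiff_const).sqrt fun _ =>
    (add_pos_of_nonneg_of_pos (sq_nonneg _) (nodoid_const_pos hl ha)).ne'

theorem nodoidR_lt_of_sin_lt (hl : lam < 0) (ha : 0 < a) {x y : ℝ} (h : sin x < sin y) :
    nodoidR lam a y < nodoidR lam a x :=
  (div_lt_div_right_of_neg (by linarith)).2 (strictMono_sub_sqrt (nodoid_const_pos hl ha) h)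

theorem nodoidR_le_of_sin_le (hl : lam < 0) (ha : 0 < a) {x y : ℝ} (h : sin x ≤ sin y) :
    nodoidR lam a y ≤ nodoidR lam a x :=
  div_le_div_of_nonpos_of_le (by linarith)
    ((strictMono_sub_sqrt (nodoid_const_pos hl ha)).monotone h)

/-- Only $a\ge0$ is assumed, because the necessity proof uses this value to derive $a_\ell>0$. -/
theorem nodoidR_zero (hl : lam < 0) (ha : 0 ≤ a) : nodoidR lam a 0 = a := by
  have h : 4 * lam ^ 2 * a ^ 2 = (2 * -lam * a) ^ 2 := by ring
  have h' : 0 ≤ 2 * -lam * a := by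
    have := neg_pos.2 hl
    positivity
  rw [nodoidR, sin_zero, h, zero_pow two_ne_zero, zero_add, Real.sqrt_sq h',
    div_eq_iff (by linarith : 2 * lam ≠ 0)]
  ring

theorem nodoidR_lt_iff (hl : lam < 0) (ha : 0 < a) {θ : ℝ} : nodoidR lam a θ < a ↔ 0 < sin θ := by
  constructor
  · intro h
    by_contra! h'
    have := nodoidR_le_of_sin_le hl ha (x := θ) (y := 0) (by rwa [sin_zero])
    rw [nodoidR_zero hl ha.le] at this
    linarith
  · intro h
    have := nodoidR_lt_of_sin_lt hl ha (x := 0) (y := θ) (by rwa [sin_zero])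
    rwa [nodoidR_zero hl ha.le] at this

theorem nodoidR_le_of_sin_nonneg (hl : lam < 0) (ha : 0 < a) {θ : ℝ} (h : 0 ≤ sin θ) :
    nodoidR lam a θ ≤ a := by
  have := nodoidR_le_of_sin_le hl ha (x := 0) (y := θ) (by rwa [sin_zero])
  rwa [nodoidR_zero hl ha.le] at this

theorem lt_nodoidR_of_sin_neg (hl : lam < 0) (ha : 0 < a) {θ : ℝ} (h : sin θ < 0) :
    a < nodoidR lam a θ := by
  have := nodoidR_lt_of_sin_lt hl ha (x := θ) (y := 0) (by rwa [sin_zero])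
  rwa [nodoidR_zero hl ha.le] at this

theorem sin_lt_nodoidD (hl : lam < 0) (ha : 0 < a) (θ : ℝ) : sin θ < nodoidD lam a θ :=
  lt_of_pow_lt_pow_left₀ 2 (nodoidD_pos hl ha θ).le (by
    rw [sq_nodoidD]
    linarith [nodoid_const_pos hl ha])

theorem nodoidR_pos (hl : lam < 0) (ha : 0 < a) (θ : ℝ) : 0 < nodoidR lam a θ :=
  div_pos_of_neg_of_neg (sub_neg.2 (sin_lt_nodoidD hl ha θ)) (by linarith)

theorem nodoidW_pos (hl : lam < 0) (ha : 0 < a) (θ : ℝ) : 0 < nodoidW lam a θ :=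
  div_pos (nodoidR_pos hl ha θ) (nodoidD_pos hl ha θ)

theorem contDiff_nodoidW (hl : lam < 0) (ha : 0 < a) : ContDiff ℝ ∞ (nodoidW lam a) := by
  have hD := contDiff_nodoidD hl ha
  have hR : ContDiff ℝ ∞ (nodoidR lam a) := (contDiff_sin.sub hD).div_const _
  exact hR.div hD fun θ => (nodoidD_pos hl ha θ).ne'

/-- The numerator is least at $\theta=\pi/2$, and the denominator is largest where $\sin^2\theta=1$.
-/
theorem exists_le_nodoidW (hl : lam < 0) (ha : 0 < a) : ∃ m > 0, ∀ θ, m ≤ nodoidW lam a θ := by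
  refine ⟨nodoidR lam a (π / 2) / √(1 + 4 * lam ^ 2 * a ^ 2),
    div_pos (nodoidR_pos hl ha _) (Real.sqrt_pos.2 (by positivity)), fun θ => ?_⟩
  refine div_le_div₀ (nodoidR_pos hl ha _).le ?_ (nodoidD_pos hl ha θ) ?_
  · exact nodoidR_le_of_sin_le hl ha (by rw [sin_pi_div_two]; exact sin_le_one θ)
  · exact Real.sqrt_le_sqrt (by linarith [sin_sq_le_one θ])

theorem hasDerivAt_nodoidR (hl : lam < 0) (ha : 0 < a) (θ : ℝ) :
    HasDerivAt (nodoidR lam a) (-nodoidW lam a θ * cos θ) θ := by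
  have hD := nodoidD_pos hl ha θ
  have hne : sin θ ^ 2 + 4 * lam ^ 2 * a ^ 2 ≠ 0 :=
    (add_pos_of_nonneg_of_pos (sq_nonneg _) (nodoid_const_pos hl ha)).ne'
  have h1 := ((hasDerivAt_sin θ).pow 2).add_const (4 * lam ^ 2 * a ^ 2) |>.sqrt hne
  refine (((hasDerivAt_sin θ).sub h1).div_const (2 * lam)).congr_deriv ?_
  rw [nodoidW, nodoidR]
  change _ = -((sin θ - nodoidD lam a θ) / (2 * lam) / nodoidD lam a θ) * cos θ
  change (cos θ - _ / (2 * nodoidD lam a θ)) / (2 * lam) = _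
  have := hl.ne
  field_simp
  norm_num
  ring

theorem nodoidZ_integrand_eq (hl : lam < 0) (ha : 0 < a) (θ : ℝ) :
    -1 / (2 * lam) * (sin θ ^ 2 / √(sin θ ^ 2 + 4 * lam ^ 2 * a ^ 2) - sin θ) =
      -nodoidW lam a θ * sin θ := by
  have hD := nodoidD_pos hl ha θ
  rw [nodoidW, nodoidR]
  change -1 / (2 * lam) * (sin θ ^ 2 / nodoidD lam a θ - sin θ) =
    -((sin θ - nodoidD lam a θ) / (2 * lam) / nodoidD lam a θ) * sin θ
  have := hl.ne
  field_simp

theorem hasDerivAt_nodoidZ (hl : lam < 0) (ha : 0 < a) (θ₀ z₀ θ : ℝ) :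
    HasDerivAt (nodoidZ lam a θ₀ z₀) (-nodoidW lam a θ * sin θ) θ := by
  have hcont : Continuous fun x => sin x ^ 2 / √(sin x ^ 2 + 4 * lam ^ 2 * a ^ 2) - sin x :=
    ((continuous_sin.pow 2).div (contDiff_nodoidD hl ha).continuous
      fun x => (nodoidD_pos hl ha x).ne').sub continuous_sin
  rw [← nodoidZ_integrand_eq hl ha]
  exact ((hcont.integral_hasStrictDerivAt θ₀ θ).hasDerivAt.const_mul _).add_const _

theorem nodoidZ_self (lam a θ₀ z₀ : ℝ) : nodoidZ lam a θ₀ z₀ θ₀ = z₀ := by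
  simp [nodoidZ]

theorem continuous_nodoidR (hl : lam < 0) (ha : 0 < a) : Continuous (nodoidR lam a) :=
  continuous_iff_continuousAt.2 fun θ => (hasDerivAt_nodoidR hl ha θ).continuousAt

theorem continuous_nodoidZ (hl : lam < 0) (ha : 0 < a) (θ₀ z₀ : ℝ) :
    Continuous (nodoidZ lam a θ₀ z₀) :=
  continuous_iff_continuousAt.2 fun θ => (hasDerivAt_nodoidZ hl ha θ₀ z₀ θ).continuousAt

theorem strictMonoOn_nodoidZ (hl : lam < 0) (ha : 0 < a) (θ₀ z₀ : ℝ) :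
    StrictMonoOn (nodoidZ lam a θ₀ z₀) (Icc (-π) 0) := by
  refine strictMonoOn_of_deriv_pos (convex_Icc _ _) (continuous_nodoidZ hl ha _ _).continuousOn
    fun θ hθ => ?_
  rw [interior_Icc] at hθ
  rw [(hasDerivAt_nodoidZ hl ha θ₀ z₀ θ).deriv]
  exact mul_pos_of_neg_of_neg (neg_neg_of_pos (nodoidW_pos hl ha θ))
    (sin_neg_of_neg_of_neg_pi_lt hθ.2 hθ.1)

theorem strictAntiOn_nodoidZ (hl : lam < 0) (ha : 0 < a) (θ₀ z₀ : ℝ) :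
    StrictAntiOn (nodoidZ lam a θ₀ z₀) (Icc 0 π) := by
  refine strictAntiOn_of_deriv_neg (convex_Icc _ _) (continuous_nodoidZ hl ha _ _).continuousOn
    fun θ hθ => ?_
  rw [interior_Icc] at hθ
  rw [(hasDerivAt_nodoidZ hl ha θ₀ z₀ θ).deriv]
  exact mul_neg_of_neg_of_pos (neg_neg_of_pos (nodoidW_pos hl ha θ))
    (sin_pos_of_pos_of_lt_pi hθ.1 hθ.2)

/-- The arcs $\theta<0$ and $\theta\ge0$ lie in $r>a$ and $r\le a$ respectively, and on each of them
the height is strictly monotone. -/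
theorem injOn_nodoid (hl : lam < 0) (ha : 0 < a) (θ₀ z₀ : ℝ) :
    InjOn (fun θ => (nodoidR lam a θ, nodoidZ lam a θ₀ z₀ θ)) (Ioc (-π) π) := by
  have key : ∀ x ∈ Ioc (-π) π, ∀ y ∈ Ioc (-π) π, x < 0 → 0 ≤ y →
      nodoidR lam a x ≠ nodoidR lam a y := fun x hx y hy hx0 hy0 =>
    ((nodoidR_le_of_sin_nonneg hl ha (sin_nonneg_of_nonneg_of_le_pi hy0 hy.2)).trans_lt
      (lt_nodoidR_of_sin_neg hl ha (sin_neg_of_neg_of_neg_pi_lt hx0 hx.1))).ne'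
  intro x hx y hy hxy
  obtain ⟨hr, hz⟩ := Prod.ext_iff.1 hxy
  simp only at hr hz
  rcases lt_or_ge x 0 with hx0 | hx0 <;> rcases lt_or_ge y 0 with hy0 | hy0
  · exact (strictMonoOn_nodoidZ hl ha θ₀ z₀).injOn ⟨hx.1.le, hx0.le⟩ ⟨hy.1.le, hy0.le⟩ hz
  · exact absurd hr (key x hx y hy hx0 hy0)
  · exact absurd hr.symm (key y hy x hx hy0 hx0)
  · exact (strictAntiOn_nodoidZ hl ha θ₀ z₀).injOn ⟨hx0, hx.2⟩ ⟨hy0, hy.2⟩ hz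

/-- The derivative along a nodoid of the linear functional vanishing on the direction `φ`. -/
theorem hasDerivAt_nodoid_linear (hl : lam < 0) (ha : 0 < a) (θ₀ z₀ φ θ : ℝ) :
    HasDerivAt (fun θ => cos φ * nodoidZ lam a θ₀ z₀ θ - sin φ * nodoidR lam a θ)
      (nodoidW lam a θ * sin (φ - θ)) θ := by
  refine (((hasDerivAt_nodoidZ hl ha θ₀ z₀ θ).const_mul (cos φ)).sub
    ((hasDerivAt_nodoidR hl ha θ).const_mul (sin φ))).congr_deriv ?_
  rw [sin_sub]
  ring

theorem exists_nodoid_isArc (hl : lam < 0) (ha : 0 < a) (θ₀ z₀ : ℝ) {lo hi : ℝ} (h : lo < hi) :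
    ∃ c : Curve, c.IsArc (nodoidR lam a) (nodoidZ lam a θ₀ z₀) lo hi lam := by
  obtain ⟨m, hm, hmw⟩ := exists_le_nodoidW hl ha
  obtain ⟨θ, ℓ, hℓ, hsm, h0, h1, hθ⟩ := exists_angle_of_density (contDiff_nodoidW hl ha) hm hmw h
  have := isArc_of_angle (h := lam) hℓ hsm (fun α => nodoidW_pos hl ha _) hθ
    (fun α => hasDerivAt_nodoidR hl ha _) (fun α => hasDerivAt_nodoidZ hl ha θ₀ z₀ _) fun α => by
      have hR := (nodoidR_pos hl ha (θ α)).ne'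
      have hD := (nodoidD_pos hl ha (θ α)).ne'
      -- Since $1/w=D/R$, twice the mean curvature is $(\sin\theta-D)/R$, and this identity turns it
      -- into $2\lambda$.
      have he : sin (θ α) - nodoidD lam a (θ α) = 2 * lam * nodoidR lam a (θ α) := by
        rw [nodoidR, mul_div_cancel₀ _ (by linarith : 2 * lam ≠ 0), nodoidD]
      rw [nodoidW]
      field_simp
      linear_combination he
  rw [h0, h1] at this
  exact ⟨_, this⟩

end Nodoid

/-! ### Catenoids -/

/-- The right side is the argument of the logarithm in $\operatorname{arcosh}(r/A)$, so this matches
the two expressions for the catenoid height. -/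
theorem one_add_cos_div_sin_arcsin {A r : ℝ} (hA : 0 < A) (hr : A ≤ r) :
    (1 + cos (arcsin (A / r))) / sin (arcsin (A / r)) = r / A + √((r / A) ^ 2 - 1) := by
  have hr0 : 0 < r := hA.trans_le hr
  have h1 : A / r ≤ 1 := (div_le_one hr0).2 hr
  have h0 : 0 < A / r := div_pos hA hr0
  rw [sin_arcsin (by linarith) h1, cos_arcsin]
  have h2 : (r / A) ^ 2 - 1 = (1 - (A / r) ^ 2) / (A / r) ^ 2 := by
    field_simp
  rw [h2, Real.sqrt_div' _ (sq_nonneg _), Real.sqrt_sq h0.le, add_div, one_div_div]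

namespace Params

variable (p : Params)

theorem z₁_θbar₁ (β : ℝ) : p.z₁ β (p.θbar₁ β) = p.zbar := nodoidZ_self _ _ _ _

theorem z₂_θbar₂ (β : ℝ) : p.z₂ β (p.θbar₂ β) = p.zbar := nodoidZ_self _ _ _ _

theorem r₃_pi_div_two : p.r₃ (π / 2) = p.A := by simp [r₃]

theorem z₃_pi_div_two : p.z₃ (π / 2) = 0 := by simp [z₃]

theorem z₃_arcsin {r : ℝ} (hA : 0 < p.A) (hr : p.A ≤ r) :
    p.z₃ (arcsin (p.A / r)) = p.A * arcosh (r / p.A) := by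
  rw [z₃, one_add_cos_div_sin_arcsin hA hr, arcosh]

theorem r₃_arcsin {r : ℝ} (hA : 0 < p.A) (hr : p.A ≤ r) : p.r₃ (arcsin (p.A / r)) = r := by
  have hr0 : 0 < r := hA.trans_le hr
  rw [r₃, sin_arcsin (by linarith [div_pos hA hr0]) ((div_le_one hr0).2 hr),
    div_div_cancel₀ hA.ne']

theorem hasDerivAt_r₃ {θ : ℝ} (hθ : 0 < sin θ) :
    HasDerivAt p.r₃ (-(p.A / sin θ ^ 2) * cos θ) θ := by
  refine ((hasDerivAt_const θ p.A).div (hasDerivAt_sin θ) hθ.ne').congr_deriv ?_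
  have := hθ.ne'
  field_simp
  ring

theorem hasDerivAt_z₃ {θ : ℝ} (hθ : 0 < sin θ) :
    HasDerivAt p.z₃ (-(p.A / sin θ ^ 2) * sin θ) θ := by
  have hc : 0 < 1 + cos θ := by
    rcases (neg_one_le_cos θ).lt_or_eq with h | h
    · linarith
    · have := sin_sq_add_cos_sq θ
      rw [← h] at this
      nlinarith
  have h1 := ((hasDerivAt_cos θ).const_add 1).div (hasDerivAt_sin θ) hθ.ne'
  refine ((h1.log (div_pos hc hθ).ne').const_mul p.A).congr_deriv ?_
  have h2 : -sin θ * sin θ - (1 + cos θ) * cos θ = -(1 + cos θ) := by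
    linear_combination -sin_sq_add_cos_sq θ
  rw [h2, Pi.div_apply]
  have := hθ.ne'
  field_simp

/-- The density $A/\sin^2\theta$ is not positive on the whole line, so `exists_angle_of_density`
does not apply. Instead, arc length from the neck is $A\cot\theta$, which inverts explicitly:
$\theta=\pi/2-\arctan(k\alpha)$ with $k=\cot(lo)$ and length $Ak$. -/
theorem exists_catenoid_isArc (hA : 0 < p.A) {lo : ℝ} (h0 : 0 < lo) (h1 : lo < π / 2) :
    ∃ c : Curve, c.IsArc p.r₃ p.z₃ lo (π / 2) 0 := by
  set k := tan (π / 2 - lo) with hk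
  have hk0 : 0 < k := tan_pos_of_pos_of_lt_pi_div_two (by linarith) (by linarith)
  set θ : ℝ → ℝ := fun α => π / 2 - arctan (k * α) with hθ
  have hsin : ∀ α, sin (θ α) = cos (arctan (k * α)) := fun α => sin_pi_div_two_sub _
  have hpos : ∀ α, 0 < sin (θ α) := fun α => by
    rw [hsin]
    exact cos_arctan_pos _
  have hsm : ContDiff ℝ ∞ θ :=
    contDiff_const.sub (contDiff_arctan.comp (contDiff_const.mul contDiff_id))
  have := isArc_of_angle (w := fun θ => p.A / sin θ ^ 2) (R := p.r₃) (Z := p.z₃) (h := 0)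
    (mul_pos hA hk0) hsm (fun α => div_pos hA (pow_pos (hpos α) 2)) (fun α => by
      refine (((hasDerivAt_id α).const_mul k).arctan.const_sub (π / 2)).congr_deriv ?_
      simp only [hsin, id]
      rw [cos_sq_arctan]
      have : (1 + (k * α) ^ 2) ≠ 0 := by positivity
      field_simp)
    (fun α => p.hasDerivAt_r₃ (hpos α)) (fun α => p.hasDerivAt_z₃ (hpos α)) fun α => by
      rw [r₃]
      have := (hpos α).ne'
      field_simp
      simp
  have e0 : θ 0 = π / 2 := by simp [hθ]
  have e1 : θ 1 = lo := by
    simp only [hθ, mul_one, hk]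
    rw [arctan_tan (by linarith) (by linarith)]
    ring
  rw [e0, e1] at this
  exact ⟨_, this⟩

end Params

/-! ### Consequences of the constraints -/

namespace ConstraintsC1C7

variable {β θc : ℝ} {p : Params}

theorem rbar_pos (h : ConstraintsC1C7 β θc p) : 0 < p.rbar := h.c1.1.trans h.c1.2.1

theorem θbar₃_mem (h : ConstraintsC1C7 β θc p) : p.θbar₃ ∈ Ioo 0 (π / 2) :=
  ⟨arcsin_pos.2 (div_pos h.c1.1 h.rbar_pos),
    arcsin_lt_pi_div_two.2 ((div_lt_one h.rbar_pos).2 h.c1.2.1)⟩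

theorem θbar₁_mem (h : ConstraintsC1C7 β θc p) (hβ : β ∈ Ioo (π / 2) π) :
    p.θbar₁ β ∈ Ioo (-π) 0 := by
  have := h.θbar₃_mem
  rw [Params.θbar₁]
  constructor <;> linarith [this.1, this.2, hβ.1, hβ.2]

/-- The lower bound does not follow from the angle ranges alone: it comes from
$r_2(\bar\theta_2)=\bar r<1=r_2(0)$, which forces $\sin\bar\theta_2>0$. -/
theorem θbar₂_mem (h : ConstraintsC1C7 β θc p) (hβ : β ∈ Ioo (π / 2) π) :
    p.θbar₂ β ∈ Ioo 0 (π / 2) := by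
  have h3 := h.θbar₃_mem
  have hsin : 0 < sin (p.θbar₂ β) :=
    (nodoidR_lt_iff h.c2 one_pos).1 (h.c4 ▸ h.c1.2.2 : p.r₂ (p.θbar₂ β) < 1)
  have hlt : p.θbar₂ β < π / 2 := by
    rw [Params.θbar₂]
    linarith [h3.2, hβ.2]
  refine ⟨?_, hlt⟩
  by_contra! hle
  refine hsin.not_ge (sin_nonpos_of_nonpos_of_neg_pi_le hle ?_)
  rw [Params.θbar₂]
  linarith [h3.1, hβ.1, pi_pos]

theorem r₃_θbar₃ (h : ConstraintsC1C7 β θc p) : p.r₃ p.θbar₃ = p.rbar :=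
  p.r₃_arcsin h.c1.1 h.c1.2.1.le

theorem z₃_θbar₃ (h : ConstraintsC1C7 β θc p) : p.z₃ p.θbar₃ = p.zbar :=
  p.z₃_arcsin h.c1.1 h.c1.2.1.le

theorem zbar_pos (h : ConstraintsC1C7 β θc p) : 0 < p.zbar :=
  mul_pos h.c1.1 (arcosh_pos ((one_lt_div h.c1.1).2 h.c1.2.1))

theorem cosh_zbar (h : ConstraintsC1C7 β θc p) : p.A * cosh (p.zbar / p.A) = p.rbar := by
  rw [Params.zbar, mul_div_cancel_left₀ _ h.c1.1.ne',
    cosh_arcosh ((one_lt_div h.c1.1).2 h.c1.2.1).le, mul_div_cancel₀ _ h.c1.1.ne']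

/-! #### The inner exterior curve -/

theorem al_lt_r₁ (h : ConstraintsC1C7 β θc p) {θ : ℝ} (h1 : -π < θ) (h0 : θ < 0) :
    p.al < p.r₁ θ :=
  lt_nodoidR_of_sin_neg h.c2 h.c3.1 (sin_neg_of_neg_of_neg_pi_lt h0 h1)

theorem r₁_le_al (h : ConstraintsC1C7 β θc p) {θ : ℝ} (h0 : 0 ≤ θ) (h1 : θ ≤ π) :
    p.r₁ θ ≤ p.al :=
  nodoidR_le_of_sin_nonneg h.c2 h.c3.1 (sin_nonneg_of_nonneg_of_le_pi h0 h1)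

theorem al_lt_rbar (h : ConstraintsC1C7 β θc p) (hβ : β ∈ Ioo (π / 2) π) : p.al < p.rbar := by
  rw [← h.c5]
  exact h.al_lt_r₁ (h.θbar₁_mem hβ).1 (h.θbar₁_mem hβ).2

theorem zbar_lt_z₁ (h : ConstraintsC1C7 β θc p) (hβ : β ∈ Ioo (π / 2) π) {θ : ℝ}
    (h1 : p.θbar₁ β < θ) (h0 : θ ≤ 0) : p.zbar < p.z₁ β θ := by
  have hm := h.θbar₁_mem hβ
  rw [← Params.z₁_θbar₁ p β]
  exact strictMonoOn_nodoidZ h.c2 h.c3.1 _ _ ⟨hm.1.le, hm.2.le⟩ ⟨(hm.1.trans h1).le, h0⟩ h1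

/-- The height rises from $\bar z>0$ until $\theta=0$ and then falls, reaching $0$ only at
$\theta_c$ by (C6). -/
theorem z₁_pos (h : ConstraintsC1C7 β θc p) (hβ : β ∈ Ioo (π / 2) π) (hθc : θc ∈ Ioc 0 π)
    {θ : ℝ} (h1 : p.θbar₁ β ≤ θ) (h0 : θ < θc) : 0 < p.z₁ β θ := by
  rcases h1.eq_or_lt with rfl | h1
  · rw [Params.z₁_θbar₁]
    exact h.zbar_pos
  · rcases le_total θ 0 with hθ | hθ
    · exact h.zbar_pos.trans (h.zbar_lt_z₁ hβ h1 hθ)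
    · rw [← h.c6]
      exact strictAntiOn_nodoidZ h.c2 h.c3.1 _ _ ⟨hθ, h0.le.trans hθc.2⟩ ⟨hθc.1.le, hθc.2⟩ h0

theorem z₁_nonneg (h : ConstraintsC1C7 β θc p) (hβ : β ∈ Ioo (π / 2) π) (hθc : θc ∈ Ioc 0 π)
    {θ : ℝ} (hθ : θ ∈ Icc (p.θbar₁ β) θc) : 0 ≤ p.z₁ β θ := by
  rcases hθ.2.eq_or_lt with rfl | h0
  · exact h.c6.ge
  · exact (h.z₁_pos hβ hθc hθ.1 h0).le

/-- For $\theta\ge0$ the radius is at most $a_\ell<1$. For $\theta\le0$ it is bounded by its value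
where the sine is least: at $-\pi/2$ if the range extends beyond it, which is (C7), and otherwise at
$\bar\theta_1$, where it is $\bar r$. -/
theorem r₁_mem (h : ConstraintsC1C7 β θc p) (hθc : θc ∈ Ioc 0 π) {θ : ℝ}
    (hθ : θ ∈ Icc (p.θbar₁ β) θc) : p.r₁ θ ∈ Ioo 0 1 := by
  refine ⟨nodoidR_pos h.c2 h.c3.1 θ, ?_⟩
  rcases le_total 0 θ with h0 | h0
  · exact (h.r₁_le_al h0 (hθ.2.trans hθc.2)).trans_lt h.c3.2
  rcases lt_or_ge (p.θbar₁ β) (-π / 2) with h2 | h2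
  · refine lt_of_le_of_lt ?_ (h.c7 h2)
    refine nodoidR_le_of_sin_le h.c2 h.c3.1 ?_
    rw [neg_div, sin_neg, sin_pi_div_two]
    exact neg_one_le_sin θ
  · refine lt_of_le_of_lt ?_ h.c1.2.2
    rw [← h.c5]
    refine nodoidR_le_of_sin_le h.c2 h.c3.1 ?_
    exact sin_le_sin_of_le_of_le_pi_div_two (by linarith) (by linarith [pi_pos]) hθ.1

/-! #### The outer exterior curve -/

theorem r₂_zero (h : ConstraintsC1C7 β θc p) : p.r₂ 0 = 1 := nodoidR_zero h.c2 zero_le_one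

theorem r₂_lt_one (h : ConstraintsC1C7 β θc p) (hβ : β ∈ Ioo (π / 2) π) {θ : ℝ}
    (h0 : 0 < θ) (h1 : θ ≤ p.θbar₂ β) : p.r₂ θ < 1 :=
  (nodoidR_lt_iff h.c2 one_pos).2
    (sin_pos_of_pos_of_lt_pi h0 (by linarith [(h.θbar₂_mem hβ).2, pi_pos]))

theorem rbar_lt_r₂ (h : ConstraintsC1C7 β θc p) (hβ : β ∈ Ioo (π / 2) π) {θ : ℝ}
    (h0 : 0 ≤ θ) (h1 : θ < p.θbar₂ β) : p.rbar < p.r₂ θ := by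
  rw [h.c4]
  exact nodoidR_lt_of_sin_lt h.c2 one_pos
    (sin_lt_sin_of_lt_of_le_pi_div_two (by linarith [pi_pos]) (h.θbar₂_mem hβ).2.le h1)

theorem rbar_le_r₂ (h : ConstraintsC1C7 β θc p) (hβ : β ∈ Ioo (π / 2) π) {θ : ℝ}
    (hθ : θ ∈ Icc 0 (p.θbar₂ β)) : p.rbar ≤ p.r₂ θ := by
  rcases hθ.2.eq_or_lt with rfl | h1
  · exact h.c4.le
  · exact (h.rbar_lt_r₂ hβ hθ.1 h1).le

theorem z₂_pos (h : ConstraintsC1C7 β θc p) (hβ : β ∈ Ioo (π / 2) π) {θ : ℝ}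
    (hθ : θ ∈ Icc 0 (p.θbar₂ β)) : 0 < p.z₂ β θ := by
  have h2 := h.θbar₂_mem hβ
  refine h.zbar_pos.trans_le ?_
  rw [← Params.z₂_θbar₂ p β]
  exact (strictAntiOn_nodoidZ h.c2 one_pos _ _).antitoneOn ⟨hθ.1, by linarith [hθ.2, h2.2, pi_pos]⟩
    ⟨h2.1.le, by linarith [h2.2, pi_pos]⟩ hθ.2

/-! #### The grain boundary -/

theorem r₃_strictAntiOn (h : ConstraintsC1C7 β θc p) : StrictAntiOn p.r₃ (Ioc 0 (π / 2)) := by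
  intro x hx y hy hxy
  exact div_lt_div_of_pos_left h.c1.1 (sin_pos_of_pos_of_lt_pi hx.1 (by linarith [hx.2, pi_pos]))
    (sin_lt_sin_of_lt_of_le_pi_div_two (by linarith [hx.1, pi_pos]) hy.2 hxy)

theorem z₃_strictAntiOn (h : ConstraintsC1C7 β θc p) : StrictAntiOn p.z₃ (Ioc 0 (π / 2)) := by
  have hs : ∀ x ∈ Ioc 0 (π / 2), 0 < sin x := fun x hx =>
    sin_pos_of_pos_of_lt_pi hx.1 (by linarith [hx.2, pi_pos])
  refine strictAntiOn_of_deriv_neg (convex_Ioc _ _)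
    (fun x hx => (p.hasDerivAt_z₃ (hs x hx)).continuousAt.continuousWithinAt) fun x hx => ?_
  have hx' := hs x (interior_subset hx)
  rw [(p.hasDerivAt_z₃ hx').deriv]
  exact mul_neg_of_neg_of_pos (neg_neg_of_pos (div_pos h.c1.1 (pow_pos hx' 2))) hx'

theorem Icc_θbar₃_subset (h : ConstraintsC1C7 β θc p) : Icc p.θbar₃ (π / 2) ⊆ Ioc 0 (π / 2) :=
  fun _ hx => ⟨h.θbar₃_mem.1.trans_le hx.1, hx.2⟩

theorem r₃_mem (h : ConstraintsC1C7 β θc p) {θ : ℝ} (hθ : θ ∈ Icc p.θbar₃ (π / 2)) :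
    p.r₃ θ ∈ Icc p.A p.rbar := by
  have h3 := h.θbar₃_mem
  have hθ' := h.Icc_θbar₃_subset hθ
  constructor
  · rw [← Params.r₃_pi_div_two p]
    exact h.r₃_strictAntiOn.antitoneOn hθ' ⟨h3.1.trans h3.2, le_rfl⟩ hθ.2
  · rw [← h.r₃_θbar₃]
    exact h.r₃_strictAntiOn.antitoneOn ⟨h3.1, h3.2.le⟩ hθ' hθ.1

theorem z₃_le_zbar (h : ConstraintsC1C7 β θc p) {θ : ℝ} (hθ : θ ∈ Icc p.θbar₃ (π / 2)) :
    p.z₃ θ ≤ p.zbar := by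
  have h3 := h.θbar₃_mem
  rw [← h.z₃_θbar₃]
  exact h.z₃_strictAntiOn.antitoneOn ⟨h3.1, h3.2.le⟩ (h.Icc_θbar₃_subset hθ) hθ.1

theorem z₃_pos (h : ConstraintsC1C7 β θc p) {θ : ℝ} (h0 : p.θbar₃ ≤ θ) (h1 : θ < π / 2) :
    0 < p.z₃ θ := by
  rw [← Params.z₃_pi_div_two p]
  exact h.z₃_strictAntiOn (h.Icc_θbar₃_subset ⟨h0, h1.le⟩) ⟨by positivity, le_rfl⟩ h1

theorem z₃_nonneg (h : ConstraintsC1C7 β θc p) {θ : ℝ} (hθ : θ ∈ Icc p.θbar₃ (π / 2)) :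
    0 ≤ p.z₃ θ := by
  rcases hθ.2.eq_or_lt with rfl | h1
  · exact (Params.z₃_pi_div_two p).ge
  · exact (h.z₃_pos hθ.1 h1).le

/-- A point of the catenary of neck radius `A` below the triple junction lies on the grain
boundary. -/
theorem mem_Γ₃ (h : ConstraintsC1C7 β θc p) {r z : ℝ} (hz : 0 ≤ z)
    (hrz : r = p.A * cosh (z / p.A)) (hr : r ≤ p.rbar) : (r, z) ∈ p.Γ₃ := by
  have hA := h.c1.1
  have hAr : p.A ≤ r := by
    rw [hrz]
    exact le_mul_of_one_le_right hA.le (one_le_cosh _)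
  refine ⟨arcsin (p.A / r), ⟨?_, arcsin_le_pi_div_two _⟩, ?_⟩
  · exact monotone_arcsin (div_le_div_of_nonneg_left hA.le (hA.trans_le hAr) hr)
  · have hc : arcosh (r / p.A) = z / p.A := by
      rw [hrz, mul_div_cancel_left₀ _ hA.ne', arcosh_cosh (div_nonneg hz hA.le)]
    simp only [p.r₃_arcsin hA hAr, p.z₃_arcsin hA hAr, hc, mul_div_cancel₀ _ hA.ne']

/-! #### Mutual position of the curves -/

theorem junction_mem_Γ₁ (h : ConstraintsC1C7 β θc p) (hβ : β ∈ Ioo (π / 2) π)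
    (hθc : θc ∈ Ioc 0 π) : (p.rbar, p.zbar) ∈ p.Γ₁ β θc :=
  ⟨p.θbar₁ β, ⟨le_rfl, ((h.θbar₁_mem hβ).2.trans hθc.1).le⟩, by
    simp only [h.c5, Params.z₁_θbar₁]⟩

theorem junction_mem_Γ₃ (h : ConstraintsC1C7 β θc p) : (p.rbar, p.zbar) ∈ p.Γ₃ :=
  ⟨p.θbar₃, ⟨le_rfl, h.θbar₃_mem.2.le⟩, by simp only [h.r₃_θbar₃, h.z₃_θbar₃]⟩

/-- Beyond the junction, the part $\theta\le0$ of $\Gamma_1$ lies above $\bar z$, hence above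
$\Gamma_3$; the part $\theta\ge0$ has $r\le a_\ell<A$, hence lies inside the neck of $\Gamma_3$. -/
theorem constraintC8 (h : ConstraintsC1C7 β θc p) (hβ : β ∈ Ioo (π / 2) π)
    (hθc : θc ∈ Ioc 0 π) (h8 : p.al < p.A) : ConstraintC8 β θc p := by
  refine Subset.antisymm ?_
    (singleton_subset_iff.2 ⟨h.junction_mem_Γ₁ hβ hθc, h.junction_mem_Γ₃⟩)
  rintro _ ⟨⟨θ, hθ, rfl⟩, φ, hφ, he⟩
  obtain ⟨hr, hz⟩ := Prod.ext_iff.1 he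
  simp only at hr hz
  rcases hθ.1.eq_or_lt with rfl | h1
  · simp only [h.c5, Params.z₁_θbar₁, mem_singleton_iff]
  · exfalso
    rcases le_total θ 0 with h0 | h0
    · linarith [h.zbar_lt_z₁ hβ h1 h0, h.z₃_le_zbar hφ]
    · linarith [h.r₁_le_al h0 (hθ.2.trans hθc.2), (h.r₃_mem hφ).1]

/-- If $\Gamma_1$ reached the substrate at radius at least $A$, it would have to cross the catenary
$r=A\cosh(z/A)$: at $\theta=0$ it is on the axis side, being above the junction with $r<\bar r$. The
crossing has $r<\bar r$, so it is a second point of $\Gamma_3$, contradicting (C8). -/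
theorem r₁_θc_lt (h : ConstraintsC1C7 β θc p) (hβ : β ∈ Ioo (π / 2) π)
    (hθc : θc ∈ Ioc 0 π) (h8 : ConstraintC8 β θc p) : p.r₁ θc < p.A := by
  by_contra! hge
  have hA := h.c1.1
  have hlt := h.al_lt_rbar hβ
  have h1 := h.θbar₁_mem hβ
  have hcont : ContinuousOn (fun θ => p.r₁ θ - p.A * cosh (p.z₁ β θ / p.A)) (Icc 0 θc) := by
    have hr : Continuous p.r₁ := continuous_nodoidR h.c2 h.c3.1
    have hz : Continuous (p.z₁ β) := continuous_nodoidZ h.c2 h.c3.1 _ _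
    exact (hr.sub (continuous_const.mul (continuous_cosh.comp (hz.div_const _)))).continuousOn
  have hz0 := h.zbar_lt_z₁ hβ h1.2 le_rfl
  have hneg : p.r₁ 0 - p.A * cosh (p.z₁ β 0 / p.A) ≤ 0 := by
    have hc : cosh (p.zbar / p.A) ≤ cosh (p.z₁ β 0 / p.A) := by
      rw [cosh_le_cosh, abs_of_pos (div_pos h.zbar_pos hA),
        abs_of_pos (div_pos (h.zbar_pos.trans hz0) hA)]
      exact (div_le_div_iff_of_pos_right hA).2 hz0.le
    have := mul_le_mul_of_nonneg_left hc hA.le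
    rw [h.cosh_zbar] at this
    linarith [h.r₁_le_al le_rfl pi_pos.le]
  have hpos : 0 ≤ p.r₁ θc - p.A * cosh (p.z₁ β θc / p.A) := by
    rw [h.c6, zero_div, cosh_zero]
    linarith
  obtain ⟨θ, hθ, h0⟩ := intermediate_value_Icc hθc.1.le hcont ⟨hneg, hpos⟩
  simp only at h0
  have hθ' : θ ∈ Icc (p.θbar₁ β) θc := ⟨h1.2.le.trans hθ.1, hθ.2⟩
  have hr := (h.r₁_le_al hθ.1 (hθ.2.trans hθc.2)).trans_lt hlt
  have hmem : (p.r₁ θ, p.z₁ β θ) ∈ p.Γ₁ β θc ∩ p.Γ₃ :=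
    ⟨⟨θ, hθ', rfl⟩, h.mem_Γ₃ (h.z₁_nonneg hβ hθc hθ') (sub_eq_zero.1 h0) hr.le⟩
  rw [h8, mem_singleton_iff, Prod.ext_iff] at hmem
  exact hr.ne hmem.1

/-- The exterior curves are separated by the tangent line of the outer one at the junction, as
long as the inner one is ascending. -/
theorem inter_exterior (h : ConstraintsC1C7 β θc p) (hβ : β ∈ Ioo (π / 2) π)
    (hθc : θc ∈ Ioc 0 π) :
    p.Γ₁ β θc ∩ (fun θ => (p.r₂ θ, p.z₂ β θ)) '' Icc 0 (p.θbar₂ β) = {(p.rbar, p.zbar)} := by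
  have h1 := h.θbar₁_mem hβ
  have h2 := h.θbar₂_mem hβ
  refine Subset.antisymm ?_ (singleton_subset_iff.2 ⟨h.junction_mem_Γ₁ hβ hθc, p.θbar₂ β,
    ⟨h2.1.le, le_rfl⟩, by simp only [← h.c4, Params.z₂_θbar₂]⟩)
  rintro _ ⟨⟨θ, hθ, rfl⟩, φ, hφ, he⟩
  obtain ⟨hr, hz⟩ := Prod.ext_iff.1 he
  simp only at hr hz
  rcases hθ.1.eq_or_lt with rfl | hlt
  · simp only [h.c5, Params.z₁_θbar₁, mem_singleton_iff]
  exfalso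
  -- On the descending part the radii already separate: $r_1\le a_\ell<\bar r\le r_2$.
  rcases lt_or_ge 0 θ with h0 | h0
  · linarith [h.r₁_le_al h0.le (hθ.2.trans hθc.2), h.rbar_le_r₂ hβ hφ, h.al_lt_rbar hβ]
  set ψ := p.θbar₂ β with hψ
  have hd₁ := hasDerivAt_nodoid_linear h.c2 h.c3.1 (p.θbar₁ β) p.zbar ψ
  have hd₂ := hasDerivAt_nodoid_linear h.c2 one_pos (p.θbar₂ β) p.zbar ψ
  have hgap : p.θbar₁ β = ψ + (π - 2 * β) := by
    rw [hψ, Params.θbar₁, Params.θbar₂]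
    ring
  -- The derivative has the sign of $\sin(\psi-x)$, and $0<\psi-x<\psi-\bar\theta_1=2\beta-\pi<\pi$.
  -- Away from the junction the inner curve is thus strictly above the tangent line.
  have hmono₁ : StrictMonoOn
      (fun θ => cos ψ * p.z₁ β θ - sin ψ * p.r₁ θ) (Icc (p.θbar₁ β) 0) := by
    refine strictMonoOn_of_deriv_pos (convex_Icc _ _)
      (fun x _ => (hd₁ x).continuousAt.continuousWithinAt) fun x hx => ?_
    rw [interior_Icc] at hx
    refine ((hd₁ x).deriv).symm ▸ mul_pos (nodoidW_pos h.c2 h.c3.1 x) ?_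
    exact sin_pos_of_pos_of_lt_pi (by linarith [hx.2, h2.1]) (by linarith [hx.1, hβ.2])
  -- Here $0\le\psi-x\le\pi$ and the junction is the upper end $x=\psi$, so the outer curve stays on
  -- or below the line.
  have hmono₂ : MonotoneOn
      (fun θ => cos ψ * p.z₂ β θ - sin ψ * p.r₂ θ) (Icc 0 ψ) := by
    refine monotoneOn_of_deriv_nonneg (convex_Icc _ _)
      (fun x _ => (hd₂ x).continuousAt.continuousWithinAt)
      (fun x _ => (hd₂ x).differentiableAt.differentiableWithinAt) fun x hx => ?_
    rw [interior_Icc] at hx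
    refine ((hd₂ x).deriv).symm ▸ mul_nonneg (nodoidW_pos h.c2 one_pos x).le ?_
    exact sin_nonneg_of_nonneg_of_le_pi (by linarith [hx.2]) (by linarith [hx.1, h2.2, pi_pos])
  have e₁ := hmono₁ ⟨le_rfl, h1.2.le⟩ ⟨hlt.le, h0⟩ hlt
  have e₂ := hmono₂ hφ ⟨h2.1.le, le_rfl⟩ hφ.2
  simp only [h.c5, Params.z₁_θbar₁] at e₁
  simp only [hψ, ← h.c4, Params.z₂_θbar₂] at e₂
  rw [hr, hz] at e₂
  linarith

/-- Off the junction the outer curve has $r>\bar r$, while the grain boundary has $r\le\bar r$. -/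
theorem inter_outer_boundary (h : ConstraintsC1C7 β θc p) (hβ : β ∈ Ioo (π / 2) π) :
    (fun θ => (p.r₂ θ, p.z₂ β θ)) '' Icc 0 (p.θbar₂ β) ∩ p.Γ₃ = {(p.rbar, p.zbar)} := by
  have h2 := h.θbar₂_mem hβ
  refine Subset.antisymm ?_ (singleton_subset_iff.2 ⟨⟨p.θbar₂ β,
    ⟨h2.1.le, le_rfl⟩, by simp only [← h.c4, Params.z₂_θbar₂]⟩, h.junction_mem_Γ₃⟩)
  rintro _ ⟨⟨θ, hθ, rfl⟩, φ, hφ, he⟩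
  obtain ⟨hr, -⟩ := Prod.ext_iff.1 he
  simp only at hr
  rcases hθ.2.eq_or_lt with rfl | hlt
  · simp only [← h.c4, Params.z₂_θbar₂, mem_singleton_iff]
  · linarith [h.rbar_lt_r₂ hβ hθ.1 hlt, (h.r₃_mem hφ).2]

end ConstraintsC1C7

/-! ### Necessity and sufficiency of the constraints -/

theorem ConstraintsC1C7.formulaIsSteadyState {β θc : ℝ} {p : Params}
    (h : ConstraintsC1C7 β θc p) (hβ : β ∈ Ioo (π / 2) π) (hθc : θc ∈ Ioc 0 π)
    (h8 : ConstraintC8 β θc p) (𝒜 ℬ : ℝ) : FormulaIsSteadyState 𝒜 ℬ β θc p := by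
  have hl := h.c2
  have ha := h.c3.1
  have hm₁ := h.θbar₁_mem hβ
  have hm₂ := h.θbar₂_mem hβ
  have hm₃ := h.θbar₃_mem
  obtain ⟨c₁, hc₁⟩ :
      ∃ c : Curve, c.IsArc p.r₁ (p.z₁ β) (p.θbar₁ β) θc p.lam :=
    exists_nodoid_isArc hl ha _ _ (hm₁.2.trans hθc.1)
  obtain ⟨c₂, hc₂⟩ :
      ∃ c : Curve, c.IsArc p.r₂ (p.z₂ β) 0 (p.θbar₂ β) p.lam :=
    exists_nodoid_isArc hl one_pos _ _ hm₂.1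
  obtain ⟨c₃, hc₃⟩ := p.exists_catenoid_isArc h.c1.1 hm₃.1 hm₃.2
  have i0 : (0 : ℝ) ∈ Icc (0 : ℝ) 1 := ⟨le_rfl, zero_le_one⟩
  have i1 : (1 : ℝ) ∈ Icc (0 : ℝ) 1 := ⟨zero_le_one, le_rfl⟩
  have hIcc : ∀ {α : ℝ}, α ∈ Ioo (0 : ℝ) 1 → α ∈ Icc (0 : ℝ) 1 := fun hα => ⟨hα.1.le, hα.2.le⟩
  have ht₁ : c₁.trace = p.Γ₁ β θc := hc₁.isExpressedBy.trace_eq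
  have ht₂ := hc₂.isExpressedBy.trace_eq
  have ht₃ : c₃.trace = p.Γ₃ := hc₃.isExpressedBy.trace_eq
  have hinj₁ : InjOn (fun θ => (p.r₁ θ, p.z₁ β θ)) (Icc (p.θbar₁ β) θc) :=
    (injOn_nodoid hl ha _ _).mono (Icc_subset_Ioc hm₁.1 hθc.2)
  have hinj₂ : InjOn (fun θ => (p.r₂ θ, p.z₂ β θ)) (Icc 0 (p.θbar₂ β)) :=
    (injOn_nodoid hl one_pos _ _).mono
      (Icc_subset_Ioc (neg_lt_zero.2 pi_pos) (by linarith [hm₂.2, pi_pos]))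
  have hr₂ : ∀ θ ∈ Icc 0 (p.θbar₂ β), p.r₂ θ ≤ 1 := fun θ hθ => by
    rcases hθ.1.eq_or_lt with h0 | h0
    · rw [← h0, h.r₂_zero]
    · exact (h.r₂_lt_one hβ h0 hθ.2).le
  have hr₃ : ∀ θ ∈ Icc p.θbar₃ (π / 2), p.r₃ θ ∈ Ioo 0 1 := fun θ hθ =>
    ⟨h.c1.1.trans_le (h.r₃_mem hθ).1, (h.r₃_mem hθ).2.trans_lt h.c1.2.2⟩
  refine ⟨⟨c₁, c₂, c₃, p.r₁ θc, p.z₂ β 0, p.A, p.rbar, p.zbar⟩, ?_,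
    hc₁.isExpressedBy, hc₂.isExpressedBy, hc₃.isExpressedBy⟩
  refine
    { adm₁ := hc₁.isAdmissibleCurve hm₁.1 hθc.2
        hinj₁
        (fun θ hθ => ⟨(h.r₁_mem hθc hθ).1.le, (h.r₁_mem hθc hθ).2.le, h.z₁_nonneg hβ hθc hθ⟩) ⊤
      adm₂ := hc₂.isAdmissibleCurve (neg_lt_zero.2 pi_pos) (by linarith [hm₂.2, pi_pos])
        hinj₂
        (fun θ hθ => ⟨h.rbar_pos.le.trans (h.rbar_le_r₂ hβ hθ), hr₂ θ hθ, (h.z₂_pos hβ hθ).le⟩) ⊤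
      adm₃ := hc₃.isAdmissibleCurve (by linarith [hm₃.1, pi_pos]) (by linarith [pi_pos])
        (fun x hx y hy hxy => h.r₃_strictAntiOn.injOn (h.Icc_θbar₃_subset hx)
          (h.Icc_θbar₃_subset hy) (Prod.ext_iff.1 hxy).1)
        (fun θ hθ => ⟨(hr₃ θ hθ).1.le, (hr₃ θ hθ).2.le, h.z₃_nonneg hθ⟩) ⊤
      motion₁ := fun _ _ α hα => by simp [hc₁.drdH_eq (hIcc hα)]
      motion₂ := fun _ _ α hα => by simp [hc₂.drdH_eq (hIcc hα)]
      motion₃ := fun _ _ α hα => by simp [hc₃.H_eq α (hIcc hα)]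
      start₁ := fun _ _ => ⟨by simp only [hc₁.r_eq, hc₁.θ_zero],
        by simp only [hc₁.z_eq, hc₁.θ_zero, h.c6]⟩
      end₁ := fun _ _ => ⟨by simp only [hc₁.r_eq, hc₁.θ_one, h.c5],
        by simp only [hc₁.z_eq, hc₁.θ_one, Params.z₁_θbar₁]⟩
      start₂ := fun _ _ => ⟨by simp only [hc₂.r_eq, hc₂.θ_zero, ← h.c4],
        by simp only [hc₂.z_eq, hc₂.θ_zero, Params.z₂_θbar₂]⟩
      end₂ := fun _ _ => ⟨by simp only [hc₂.r_eq, hc₂.θ_one, h.r₂_zero],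
        by simp only [hc₂.z_eq, hc₂.θ_one]⟩
      start₃ := fun _ _ => ⟨by simp only [hc₃.r_eq, hc₃.θ_zero, Params.r₃_pi_div_two],
        by simp only [hc₃.z_eq, hc₃.θ_zero, Params.z₃_pi_div_two]⟩
      end₃ := fun _ _ => ⟨by simp only [hc₃.r_eq, hc₃.θ_one, h.r₃_θbar₃],
        by simp only [hc₃.z_eq, hc₃.θ_one, h.z₃_θbar₃]⟩
      points_order := fun _ _ => ⟨nodoidR_pos hl ha _, h.r₁_θc_lt hβ hθc h8,
        h.c1.2.1.trans h.c1.2.2, h.z₂_pos hβ ⟨le_rfl, hm₂.1.le⟩, h.rbar_pos, h.c1.2.2, h.zbar_pos⟩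
      force_substrate₁ := fun _ _ => ⟨by
        simp only
        rw [← hc₁.cos_θ 0 i0, hc₁.θ_zero], hc₁.θ_zero⟩
      force_cylinder := fun _ _ => ⟨by
        simp only
        rw [← hc₂.sin_θ 1 i1, hc₂.θ_one, sin_zero], hc₂.θ_one⟩
      force_substrate₃ := fun _ _ => ⟨by
        simp only
        rw [← hc₃.cos_θ 0 i0, hc₃.θ_zero, cos_pi_div_two], hc₃.θ_zero⟩
      force_junction₁ := fun _ _ => ⟨by
        simp only
        rw [← hc₁.cos_θ 1 i1, ← hc₁.sin_θ 1 i1, ← hc₃.cos_θ 1 i1, ← hc₃.sin_θ 1 i1, ← cos_sub,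
          hc₁.θ_one, hc₃.θ_one, Params.θbar₁, ← cos_neg]
        congr 1
        ring, by
        simp only [hc₁.θ_one, hc₃.θ_one, Params.θbar₁]
        ring⟩
      force_junction₂ := fun _ _ => ⟨by
        simp only
        rw [← hc₂.cos_θ 0 i0, ← hc₂.sin_θ 0 i0, ← hc₃.cos_θ 1 i1, ← hc₃.sin_θ 1 i1, ← cos_sub,
          hc₂.θ_zero, hc₃.θ_one, Params.θbar₂, ← cos_add_pi]
        congr 1
        ring, by
        simp only [hc₂.θ_zero, hc₃.θ_one, Params.θbar₂]
        ring⟩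
      chemical_potential := fun _ _ => (hc₁.H_eq 1 i1).trans (hc₂.H_eq 0 i0).symm
      flux_substrate := fun _ _ => hc₁.dH_eq i0
      flux_junction := fun _ _ => by
        simp only
        rw [hc₁.dH_eq i1, hc₂.dH_eq i0, zero_div, zero_div]
      flux_cylinder := fun _ _ => hc₂.dH_eq i1
      r₁_mem := fun _ _ α hα => by
        simp only [hc₁.r_eq]
        exact h.r₁_mem hθc (hc₁.mem_Icc hα)
      r₃_mem := fun _ _ α hα => by
        simp only [hc₃.r_eq]
        exact hr₃ _ (hc₃.mem_Icc hα)
      r₂_mem := fun _ _ α hα => by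
        have hmem := hc₂.mem_Icc ⟨hα.1, hα.2.le⟩
        have hpos : 0 < c₂.θ α := hc₂.θ_one ▸ hc₂.strictAnti hα.2
        simp only [hc₂.r_eq]
        exact ⟨h.rbar_pos.trans_le (h.rbar_le_r₂ hβ hmem), h.r₂_lt_one hβ hpos hmem.2⟩
      z₁_pos := fun _ _ α hα => by
        simp only [hc₁.z_eq]
        exact h.z₁_pos hβ hθc (hc₁.mem_Icc ⟨hα.1.le, hα.2⟩).1 (by
          rw [← hc₁.θ_zero]
          exact hc₁.strictAnti hα.1)
      z₃_pos := fun _ _ α hα => by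
        simp only [hc₃.z_eq]
        exact h.z₃_pos (hc₃.mem_Icc ⟨hα.1.le, hα.2⟩).1 (by
          rw [← hc₃.θ_zero]
          exact hc₃.strictAnti hα.1)
      z₂_pos := fun _ _ α hα => by
        simp only [hc₂.z_eq]
        exact h.z₂_pos hβ (hc₂.mem_Icc hα)
      inter₁₂ := fun _ _ => by
        simp only [ht₁, ht₂]
        exact h.inter_exterior hβ hθc
      inter₁₃ := fun _ _ => by
        simp only [ht₁, ht₃]
        exact h8
      inter₂₃ := fun _ _ => by
        simp only [ht₂, ht₃]
        exact h.inter_outer_boundary hβ }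

/-- A simple curve expressed in terms of its angle has a strictly monotone angle; if the angle
starts at the upper end of its range, it ends at the lower one. -/
theorem Curve.IsExpressedBy.θ_one {c : Curve} {R Z : ℝ → ℝ} {lo hi : ℝ}
    (hc : c.IsExpressedBy R Z lo hi) (hcont : ContinuousOn c.θ (Icc 0 1))
    (hinj : InjOn (fun α => (c.r α, c.z α)) (Icc (0 : ℝ) 1)) (h0 : c.θ 0 = hi) :
    c.θ 1 = lo ∧ lo < hi := by
  have i0 : (0 : ℝ) ∈ Icc (0 : ℝ) 1 := ⟨le_rfl, zero_le_one⟩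
  have i1 : (1 : ℝ) ∈ Icc (0 : ℝ) 1 := ⟨zero_le_one, le_rfl⟩
  have hmem : ∀ {α}, α ∈ Icc (0 : ℝ) 1 → c.θ α ∈ Icc lo hi := fun hα =>
    hc.1 ▸ mem_image_of_mem _ hα
  -- A point of the curve is determined by its angle, so a repeated angle would be a
  -- self-intersection.
  have hθ : InjOn c.θ (Icc 0 1) := fun x hx y hy hxy => hinj hx hy (by
    simp only [(hc.2 x hx).1, (hc.2 x hx).2, (hc.2 y hy).1, (hc.2 y hy).2, hxy])
  have hanti : StrictAntiOn c.θ (Icc 0 1) := by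
    -- An increasing angle is impossible, since it starts at the maximum of its range.
    rcases hcont.strictMonoOn_of_injOn_Icc' zero_le_one hθ with h | h
    · have h1 := h i0 i1 zero_lt_one
      linarith [(hmem i1).2]
    · exact h
  have hlt : c.θ 1 < c.θ 0 := hanti i0 i1 zero_lt_one
  refine ⟨le_antisymm ?_ (hmem i1).1, by linarith [(hmem i1).1]⟩
  obtain ⟨α, hα, he⟩ : lo ∈ c.θ '' Icc 0 1 := by
    rw [hc.1]
    exact ⟨le_rfl, by linarith [(hmem i1).1]⟩
  rw [← he]
  exact hanti.antitoneOn hα i1 hα.2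

theorem FormulaIsSteadyState.constraints {𝒜 ℬ β θc : ℝ} {p : Params}
    (hS : FormulaIsSteadyState 𝒜 ℬ β θc p) (hβ : β ∈ Ioo (π / 2) π) (hθc : θc ∈ Ioc 0 π)
    (hal : 0 ≤ p.al) : ConstraintsC1C7 β θc p ∧ ConstraintC8 β θc p := by
  obtain ⟨S, hS, e₁, e₂, e₃⟩ := hS
  have t0 : (0 : ℝ) ∈ timeCO ⊤ := ⟨le_rfl, EReal.coe_lt_top 0⟩
  have i0 : (0 : ℝ) ∈ Icc (0 : ℝ) 1 := ⟨le_rfl, zero_le_one⟩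
  have i1 : (1 : ℝ) ∈ Icc (0 : ℝ) 1 := ⟨zero_le_one, le_rfl⟩
  obtain ⟨hr₁, hr₁₃, hr₃, -, hrJ, hrJ1, -⟩ := hS.points_order 0 t0
  -- the grain boundary
  have h3₀ : S.Γ₃.θ 0 = π / 2 := (hS.force_substrate₃ 0 t0).2
  have hcont : ContinuousOn S.Γ₃.θ (Icc 0 1) :=
    hS.adm₃.continuous_θ.comp (f := fun α : ℝ => (α, (0 : ℝ))) (by fun_prop)
      fun α hα => ⟨hα, t0⟩
  obtain ⟨h3₁, h3lt⟩ := e₃.θ_one hcont (hS.adm₃.not_self_intersecting 0 t0) h3₀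
  have hA : p.A = S.r₃s := by
    rw [← (hS.start₃ 0 t0).1, (e₃.2 0 i0).1, h3₀, Params.r₃_pi_div_two]
  have hApos : 0 < p.A := by
    rw [hA]
    exact hr₁.trans hr₁₃
  have hrJ₃ : S.rJ = p.r₃ p.θbar₃ := by
    rw [← h3₁, ← (e₃.2 1 i1).1]
    exact (hS.end₃ 0 t0).1.symm
  -- Neither the sign of $\bar r$ nor $A/\bar r\le1$ is known yet, and `arcsin` is clamped outside
  -- $[-1,1]$. Positivity of $r_J=A/\sin\bar\theta_3$ gives $\bar\theta_3>0$, hence $\bar r>0$; then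
  -- $\bar\theta_3<\pi/2$ excludes clamping and gives $A<\bar r$.
  have hsin : 0 < sin p.θbar₃ := by
    rw [hrJ₃, Params.r₃] at hrJ
    exact (div_pos_iff_of_pos_left hApos).1 hrJ
  have h3pos : 0 < p.θbar₃ := by
    have hge : -(π / 2) ≤ p.θbar₃ := neg_pi_div_two_le_arcsin _
    by_contra! hle
    exact hsin.not_ge (sin_nonpos_of_nonpos_of_neg_pi_le hle (by linarith [pi_pos]))
  have hquot : 0 < p.A / p.rbar := arcsin_pos.1 h3pos
  have hrbar : 0 < p.rbar := (div_pos_iff_of_pos_left hApos).1 hquot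
  have hAr : p.A < p.rbar := (div_lt_one hrbar).1 (arcsin_lt_pi_div_two.1 h3lt)
  have hJr : S.rJ = p.rbar := hrJ₃.trans (p.r₃_arcsin hApos hAr.le)
  have hJz : S.zJ = p.zbar := by
    rw [← show S.Γ₃.z 1 = S.zJ from (hS.end₃ 0 t0).2, (e₃.2 1 i1).2, h3₁]
    exact p.z₃_arcsin hApos hAr.le
  -- the exterior curves
  have h1₀ : S.Γ₁.θ 0 = θc := (hS.force_substrate₁ 0 t0).2
  have h1₁ : S.Γ₁.θ 1 = p.θbar₁ β := by
    have : -S.Γ₁.θ 1 + S.Γ₃.θ 1 = β := (hS.force_junction₁ 0 t0).2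
    rw [Params.θbar₁]
    linarith
  have h2₀ : S.Γ₂.θ 0 = p.θbar₂ β := by
    have : S.Γ₂.θ 0 - S.Γ₃.θ 1 = -π + β := (hS.force_junction₂ 0 t0).2
    rw [Params.θbar₂]
    linarith
  have h2₁ : S.Γ₂.θ 1 = 0 := (hS.force_cylinder 0 t0).2
  have hr₂ : p.r₂ 0 = 1 := by
    rw [← h2₁, ← (e₂.2 1 i1).1]
    exact (hS.end₂ 0 t0).1
  -- If $\lambda\ge0$ then $r_2(0)\le0$, including $\lambda=0$, where the quotient is $0$ by
  -- convention; but $r_2(0)=1$.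
  have hlam : p.lam < 0 := by
    by_contra! hge
    rw [Params.r₂, nodoidR, sin_zero, zero_sub] at hr₂
    have : -√(0 ^ 2 + 4 * p.lam ^ 2 * 1 ^ 2) / (2 * p.lam) ≤ 0 :=
      div_nonpos_of_nonpos_of_nonneg (neg_nonpos.2 (Real.sqrt_nonneg _)) (by linarith)
    linarith
  have hr₁mem : ∀ θ ∈ Icc (p.θbar₁ β) θc, p.r₁ θ ∈ Ioo 0 1 := fun θ hθ => by
    rw [← e₁.1] at hθ
    obtain ⟨α, hα, rfl⟩ := hθ
    rw [← (e₁.2 α hα).1]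
    exact hS.r₁_mem 0 t0 α hα
  have h1neg : p.θbar₁ β < 0 := by
    rw [Params.θbar₁]
    linarith [hβ.1]
  -- The range of $\theta_1$ contains $0$, where the radius is $a_\ell$; this yields (C3).
  have hr₁0 := hr₁mem 0 ⟨h1neg.le, hθc.1.le⟩
  rw [Params.r₁, nodoidR_zero hlam hal] at hr₁0
  refine ⟨⟨⟨hApos, hAr, hJr ▸ hrJ1⟩, hlam, hr₁0, ?_, ?_, ?_, fun h => ?_⟩, ?_⟩
  · rw [← hJr, ← h2₀, ← (e₂.2 0 i0).1]
    exact (hS.start₂ 0 t0).1.symm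
  · rw [← hJr, ← h1₁, ← (e₁.2 1 i1).1]
    exact (hS.end₁ 0 t0).1
  · rw [← h1₀, ← (e₁.2 0 i0).2]
    exact (hS.start₁ 0 t0).2
  · exact (hr₁mem (-π / 2) ⟨h.le, by linarith [hθc.1, pi_pos]⟩).2
  · have := hS.inter₁₃ 0 t0
    simp only [e₁.trace_eq, e₃.trace_eq, hJr, hJz] at this
    exact this

end GrainHole

theorem theorem4p11 (𝒜 ℬ : ℝ) (h𝒜 : 0 < 𝒜) (hℬ : 0 < ℬ) (β θc : ℝ)
    (hβ : β ∈ Set.Ioo (Real.pi / 2) Real.pi) (hθc : θc ∈ Set.Ioc 0 Real.pi)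
    (p : GrainHole.Params) (hal : 0 ≤ p.al) :
    (GrainHole.FormulaIsSteadyState 𝒜 ℬ β θc p ↔
      GrainHole.ConstraintsC1C7 β θc p ∧ GrainHole.ConstraintC8 β θc p) ∧
    (GrainHole.ConstraintsC1C7 β θc p → GrainHole.ConstraintC8' p →
      GrainHole.ConstraintC8 β θc p) :=
  ⟨⟨fun h => h.constraints hβ hθc hal, fun h => h.1.formulaIsSteadyState hβ hθc h.2 𝒜 ℬ⟩,
    fun h h8 => h.constraintC8 hβ hθc h8⟩
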